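/- **Setting.** Let $\mathcal Z$ be a countable connected graph with graph distance $\mathrm d$ and polynomially bounded growth of balls: $|\{y:\mathrm d(x,y)\le L\}|\le C_dL^d$ for all $x\in\mathcal Z$ and all integers $L\ge1$ (with $d,C_d>0$). Let $n(x)$ be the number of neighbours of $x$. Let $V=(V(x))_{x\in\mathcal Z}$ be an IID random field whose marginal distribution function satisfies $F_V(t+s)-F_V(t)\le C_Ws$ for all $t\in\mathbb R$, $s\ge0$ (with $C_W>0$). For a finite set $\Lambda\subset\mathcal Z$ let $H_\Lambda$ be the Schrödinger operator on $\ell^2(\Lambda)$ with Dirichlet boundary conditions, $(H_\Lambda f)(x)=(n(x)+V(x))f(x)-\sum_{y\in\Lambda,\ \mathrm d(x,y)=1}f(y)$, let $\Sigma(H_\Lambda)$ be its spectrum and, for $E\notin\Sigma(H_\Lambda)$, $G_\Lambda(x,y;E)=(H_\Lambda-E)^{-1}(x,y)$. For a finite set $\mathcal G\subset\mathcal Z$ of vertices whose induced subgraph is connected, let $\mathrm d_{\mathcal G}$ be the path distance of that subgraph, and for $u\in\mathcal G$ and real $L>0$ let $B=B^{\mathcal G}_L(u)=\{y\in\mathcal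 G:\mathrm d_{\mathcal G}(u,y)\le L\}$ be the ball relative to $(\mathcal G,\mathrm d_{\mathcal G})$. (Every ball of $\mathcal Z$ is of this form.) Fix parameters $1<\alpha<2$, $\beta>0$, $0<\tau<\varrho<\alpha-1$ with $\alpha\beta+\tau<1+\varrho$ (for example $\alpha=4/3$ or $\alpha=3/2$, with $\beta=1/2$, $\tau=1/8$, $\varrho=1/6$), and put $\gamma(m,L)=m(1+L^{-\tau})$. Given $E\in\mathbb R$ and $m>0$, the ball $B$ is called * *$E$-resonant* if $\operatorname{dist}(E,\Sigma(H_B))<e^{-L^\beta}$; * *$(E,m)$-nonsingular* if $E\notin\Sigma(H_B)$ and $C_d^2L^d\,|G_B(x,y;E)|\le e^{-\gamma(m,L)\,\mathrm d_{\mathcal G}(x,y)}$ for all $x,y\in B$ with $\mathrm d_{\mathcal G}(x,y)\ge L^{(1+\varrho)/\alpha}$, and *$(E,m)$-singular* otherwise. For an integer $L_0\ge 1$ let $L_{k+1}=L_k^\alpha$, and let $$P_k=\sup_{\mathcal G,u}\mathbb P\{B^{\mathcal G}_{L_k}(u)\text{ is }(E,m)\text{-singular}\},\qquad Q_k=2\sup_{\mathcal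 G,u}\mathbb P\{B^{\mathcal G}_{L_k}(u)\text{ is }E\text{-resonant}\},$$ the suprema being over all finite connected $\mathcal G\subset\mathcal Z$ and all $u\in\mathcal G$. **Theorem.** Let $\kappa\ge\frac{2\alpha d}{2-\alpha}$ and $m_0>0$. There is an integer $L_*\ge1$, depending only on $d,C_d,\alpha,\beta,\tau,\varrho,C_W,m_0,\kappa$, such that the following holds for every graph $\mathcal Z$ and random field $V$ as above (with these constants), all $E\in\mathbb R$, all $m\ge m_0$ and all integers $L_0\ge L_*$. 1. If $\max\{P_0,Q_0\}\le C_d^{-2}L_0^{-\kappa}$, then $P_k\le C_d^{-2}L_k^{-\kappa}$ for all $k\ge0$. 2. If $\kappa>\frac{2\alpha d}{2-\alpha}$, then $\theta:=\frac2\alpha-\frac{2d}\kappa-1>0$, and if $P_{k_0}\le C_d^{-2}L_{k_0}^{-\kappa(1+\theta)^{k_0}}$ for some $k_0\ge0$ (for $k_0=0$ this reads $P_0\le C_d^{-2}L_0^{-\kappa}$), then $P_k\le C_d^{-2}L_k^{-\kappa(1+\theta)^k}$ for all $k\ge k_0$. In particular $P_k$ then decays faster than any power of $L_k$: $L_k^AP_k\to0$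 as $k\to\infty$ for every $A\in\mathbb R$. -/

import Mathlib

open MeasureTheory ProbabilityTheory Filter Topology

noncomputable section

namespace MSA

universe u v

variable {V : Type u}

/-- Polynomially bounded growth: every ball of integer radius `L ≥ 1` is finite and has at most
`C * L ^ d` vertices. -/
def PolynomialGrowth (Z : SimpleGraph V) (C d : ℝ) : Prop :=
  ∀ (x : V) (L : ℕ), 1 ≤ L →
    {y : V | Z.dist x y ≤ L}.Finite ∧ ({y : V | Z.dist x y ≤ L}.ncard : ℝ) ≤ C * (L : ℝ) ^ d

/-- The path distance of the subgraph of `Z` induced on the vertex set `G`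
(only used for connected `G` and for points of `G`). -/
def relDist (Z : SimpleGraph V) (G : Finset V) (x y : V) : ℕ :=
  (Z.induce (G : Set V)).spanningCoe.dist x y

open Classical in
/-- The ball of radius `L` about `u` relative to the metric space `(G, d_G)`. -/
def relBall (Z : SimpleGraph V) (G : Finset V) (u : V) (L : ℝ) : Finset V :=
  G.filter fun y => (relDist Z G u y : ℝ) ≤ L

open Classical in
/-- The kernel of the discrete Schrödinger operator `-Δ + v` on the whole graph `Z`,
`(-Δ f)(x) = n(x) f(x) - ∑ f(y)` with the sum over the nearest neighbours of `x`. -/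
def schrodinger (Z : SimpleGraph V) (v : V → ℝ) : Matrix V V ℝ :=
  Matrix.of fun x y =>
    (if x = y then ((Z.neighborSet x).ncard : ℝ) + v x else 0) - (if Z.Adj x y then 1 else 0)

/-- The operator `H_Λ = 1_Λ (-Δ + v) 1_Λ` on `ℓ²(Λ)`: Dirichlet boundary conditions. -/
def dirichlet (Z : SimpleGraph V) (v : V → ℝ) (Λ : Finset V) : Matrix Λ Λ ℝ :=
  (schrodinger Z v).submatrix (fun x : Λ => (x : V)) (fun x : Λ => (x : V))

open Classical in
/-- The spectrum of `H_Λ`. -/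
def spec (Z : SimpleGraph V) (v : V → ℝ) (Λ : Finset V) : Set ℝ :=
  spectrum ℝ (dirichlet Z v Λ)

open Classical in
/-- The Green function `(H_Λ - E)⁻¹ (x, y)`, meaningful for `E` outside the spectrum of `H_Λ`. -/
def green (Z : SimpleGraph V) (v : V → ℝ) (Λ : Finset V) (E : ℝ) (x y : Λ) : ℝ :=
  ((dirichlet Z v Λ - E • (1 : Matrix Λ Λ ℝ))⁻¹) x y

/-- The numerical parameters: growth exponent `d` and growth constant `C` of the graph,
scale exponent `α`, and the exponents `β`, `τ`, `ϱ`. -/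
structure Params where
  d : ℝ
  C : ℝ
  α : ℝ
  β : ℝ
  τ : ℝ
  ϱ : ℝ

/-- `γ(m, L) = m (1 + L ^ (-τ))`. -/
def gam (p : Params) (m L : ℝ) : ℝ := m * (1 + L ^ (-p.τ))

/-- The ball `B_L(u)` of `G` is `E`-resonant. -/
def Resonant (p : Params) (Z : SimpleGraph V) (v : V → ℝ) (E : ℝ)
    (G : Finset V) (u : V) (L : ℝ) : Prop :=
  Metric.infDist E (spec Z v (relBall Z G u L)) < Real.exp (-L ^ p.β)

/-- The ball `B_L(u)` of `G` is `(E, m)`-nonsingular. A ball whose spectrum contains `E`, so that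
its Green function at energy `E` does not exist, is not nonsingular. -/
def Nonsingular (p : Params) (Z : SimpleGraph V) (v : V → ℝ) (E m : ℝ)
    (G : Finset V) (u : V) (L : ℝ) : Prop :=
  E ∉ spec Z v (relBall Z G u L) ∧
    ∀ x y : relBall Z G u L, L ^ ((1 + p.ϱ) / p.α) ≤ (relDist Z G x y : ℝ) →
      p.C ^ 2 * L ^ p.d * |green Z v (relBall Z G u L) E x y|
        ≤ Real.exp (-(gam p m L * (relDist Z G x y : ℝ)))

/-- `P(L)`: the supremum, over all balls of radius `L` of all finite connected subgraphs of `Z`,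
of the probability that the ball is `(E, m)`-singular. -/
def probSingular {Ω : Type v} [MeasurableSpace Ω] (p : Params) (Z : SimpleGraph V)
    (μ : Measure Ω) (X : V → Ω → ℝ) (E m L : ℝ) : ℝ :=
  sSup {r : ℝ | ∃ (G : Finset V) (u : V), (Z.induce (G : Set V)).Connected ∧ u ∈ G ∧
    r = μ.real {ω | ¬ Nonsingular p Z (fun x => X x ω) E m G u L}}

/-- `Q(L)`: twice the supremum, over the same balls, of the probability that the ball is
`E`-resonant. -/
def probResonant {Ω : Type v} [MeasurableSpace Ω] (p : Params) (Z : SimpleGraph V)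
    (μ : Measure Ω) (X : V → Ω → ℝ) (E L : ℝ) : ℝ :=
  2 * sSup {r : ℝ | ∃ (G : Finset V) (u : V), (Z.induce (G : Set V)).Connected ∧ u ∈ G ∧
    r = μ.real {ω | Resonant p Z (fun x => X x ω) E G u L}}

/-- The length scales `L_{k+1} = L_k ^ α`. -/
def scale (α : ℝ) (L₀ : ℕ) : ℕ → ℝ
  | 0 => (L₀ : ℝ)
  | k + 1 => scale α L₀ k ^ α

/-- `X` is an IID random field whose marginal distribution function is Lipschitz continuous with
constant `W`. -/
def LipschitzIID {Ω : Type v} [MeasurableSpace Ω] (μ : Measure Ω) (X : V → Ω → ℝ) (W : ℝ) : Prop :=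
  (∀ x, Measurable (X x)) ∧ iIndepFun X μ ∧ (∀ x y, IdentDistrib (X x) (X y) μ μ) ∧
    ∀ x, ∀ t s : ℝ, 0 ≤ s → cdf (μ.map (X x)) (t + s) - cdf (μ.map (X x)) t ≤ W * s

end MSA

end

/-!
The proof is the multi-scale analysis at a fixed energy. Write `l = L_k`, `L = l ^ α`, and let `B`
be a ball of radius `L`, viewed as a finite connected graph with its own path distance.

*Deterministic part.* Suppose that `B` is not resonant and that its singular sub-balls of radius
`l` pairwise intersect. Then all singular centres lie in one ball of radius `2 l`. The geometric
resolvent identity (`eq_sum_green_mul`) shows that at every other centre the Green function of `B`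
contracts by the factor `exp (-γ(m, l) ⌊l⌋)` over a step of length `⌊l⌋ + 1`
(`abs_greenCol_le_of_nonsingular`). Since the Green function is symmetric, steps can be taken from
both arguments, and together they cover the whole distance `R` except for a bounded number of
steps lost at the singular cluster (`le_pow_mul_of_bad_cluster`). Where no step is possible the
Green function is bounded by `exp (L ^ β)`, as `B` is nonresonant. For `R ≥ l ^ (1 + ϱ)` the
losses are smaller than the gain from replacing `γ(m, l)` by `γ(m, L)`, because `τ < ϱ` and
`α β + τ < 1 + ϱ`; so `B` is nonsingular (`eventually_nonsingular`).

*Probabilistic part.* A singular ball is therefore resonant or contains two disjoint singular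
balls, which are independent. There are at most `(C L ^ d) ^ 2 / 2` unordered pairs of centres, so
`P_{k+1} ≤ (C L ^ d) ^ 2 P_k ^ 2 / 2 + Q_{k+1} / 2` (`probSingular_le_of_step`). The condition
`κ ≥ 2 α d / (2 - α)` says that the first term reproduces the bound `C⁻² L ^ (-κ)`; the number `θ`
is chosen so that the exponent improves by the factor `1 + θ`.

*Wegner estimate.* The term `Q_{k+1}` is bounded by a power of `L` times `exp (-L ^ β)`
(`probResonant_le`). If `E` is within `ε` of the spectrum of `H_Λ`, the trace of
`(H_Λ - E - iε)⁻¹` has imaginary part at least `1 / (2 ε)`, so one of its diagonal entries is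
large (`exists_le_norm_inv_apply_self`). By Cramer's rule that entry is `c / (c V(x) + e)` with
`c` and `e` independent of `V(x)`, hence it is large only if `V(x)` falls into a short interval
determined by the other values of the potential (`measureReal_le_norm_inv_apply_self_le`). Since
`L_k ^ (β / 4) ≥ 2 ^ k ≥ (1 + θ) ^ k`, this bound beats the required powers of `L_k` at all
scales (`eventually_wegner_bound_le`).
-/

namespace MSA

universe u v

section

variable {V : Type u} {Z : SimpleGraph V} {G : Finset V}

/-! ### The path distance of a connected finite subgraph -/

lemma adj_spanningCoe_induce {s : Set V} {x y : V} :
    (Z.induce s).spanningCoe.Adj x y ↔ Z.Adj x y ∧ x ∈ s ∧ y ∈ s := by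
  simp [SimpleGraph.map_adj]

lemma reachable_spanningCoe (hG : (Z.induce (G : Set V)).Connected) {x y : V}
    (hx : x ∈ G) (hy : y ∈ G) : (Z.induce (G : Set V)).spanningCoe.Reachable x y :=
  (hG.preconnected ⟨x, hx⟩ ⟨y, hy⟩).map
    (SimpleGraph.Embedding.spanningCoe (Z.induce (G : Set V))).toHom

lemma relDist_comm (x y : V) : relDist Z G x y = relDist Z G y x :=
  SimpleGraph.dist_comm

@[simp]
lemma relDist_self (x : V) : relDist Z G x x = 0 :=
  SimpleGraph.dist_self

lemma relDist_triangle (hG : (Z.induce (G : Set V)).Connected) {x y : V}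
    (hx : x ∈ G) (hy : y ∈ G) (z : V) : relDist Z G x z ≤ relDist Z G x y + relDist Z G y z :=
  (reachable_spanningCoe hG hx hy).dist_triangle_left z

lemma relDist_le_one_of_adj {x y : V} (hx : x ∈ G) (hy : y ∈ G) (h : Z.Adj x y) :
    relDist Z G x y ≤ 1 :=
  (SimpleGraph.dist_eq_one_iff_adj.2 (adj_spanningCoe_induce.2 ⟨h, hx, hy⟩)).le

lemma exists_adj_relDist_eq {x y : V} {k : ℕ} (h : relDist Z G x y = k + 1) :
    ∃ y' ∈ G, Z.Adj y' y ∧ relDist Z G x y' = k := by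
  have hr : (Z.induce (G : Set V)).spanningCoe.Reachable y x := by
    refine (SimpleGraph.Reachable.of_dist_ne_zero ?_).symm
    rw [relDist] at h
    omega
  obtain ⟨w, hw⟩ := hr.exists_walk_length_eq_dist
  rw [SimpleGraph.dist_comm] at hw
  change w.length = relDist Z G x y at hw
  cases w with
  | nil => simp at h
  | @cons _ y' _ hadj w =>
    have hadj' := adj_spanningCoe_induce.1 hadj
    refine ⟨y', hadj'.2.2, hadj'.1.symm, ?_⟩
    have h1 : relDist Z G x y' ≤ w.length := by
      rw [relDist, SimpleGraph.dist_comm]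
      exact SimpleGraph.dist_le w
    have h2 : relDist Z G x y ≤ relDist Z G x y' + 1 := by
      have := hadj.symm.reachable.dist_triangle_right x
      rw [SimpleGraph.dist_eq_one_iff_adj.2 hadj.symm] at this
      exact this
    rw [SimpleGraph.Walk.length_cons] at hw
    omega

lemma mem_relBall {u y : V} {L : ℝ} :
    y ∈ relBall Z G u L ↔ y ∈ G ∧ (relDist Z G u y : ℝ) ≤ L := by
  classical
  simp [relBall]

lemma relBall_subset (u : V) (L : ℝ) : relBall Z G u L ⊆ G :=
  fun _ h => (mem_relBall.1 h).1

lemma mem_relBall_self {u : V} (hu : u ∈ G) {L : ℝ} (hL : 0 ≤ L) : u ∈ relBall Z G u L :=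
  mem_relBall.2 ⟨hu, by simpa using hL⟩

/-- A ball relative to a connected graph is itself connected: it contains the geodesics
from its centre. -/
lemma relBall_connected (hG : (Z.induce (G : Set V)).Connected) {u : V} (hu : u ∈ G)
    {L : ℝ} (hL : 0 ≤ L) : (Z.induce (relBall Z G u L : Set V)).Connected := by
  have hu' := mem_relBall_self (Z := Z) hu hL
  have key : ∀ (k : ℕ) (y : V) (hy : y ∈ relBall Z G u L), relDist Z G u y = k →
      (Z.induce (relBall Z G u L : Set V)).Reachable ⟨u, hu'⟩ ⟨y, hy⟩ := by
    intro k
    induction k with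
    | zero =>
      intro y hy h
      obtain rfl : u = y :=
        ((reachable_spanningCoe hG hu (mem_relBall.1 hy).1).dist_eq_zero_iff).1 h
      exact SimpleGraph.Reachable.refl _
    | succ k ih =>
      intro y hy h
      obtain ⟨y', hy'G, hadj, hd⟩ := exists_adj_relDist_eq h
      have hy' : y' ∈ relBall Z G u L := by
        refine mem_relBall.2 ⟨hy'G, le_trans ?_ (mem_relBall.1 hy).2⟩
        rw [h, hd]
        push_cast
        linarith
      refine (ih y' hy' hd).trans (SimpleGraph.Adj.reachable ?_)
      simpa using hadj
  have : Nonempty (relBall Z G u L : Set V) := ⟨⟨u, hu'⟩⟩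
  refine SimpleGraph.Connected.mk fun x y => ?_
  exact ((key _ x.1 x.2 rfl).symm).trans (key _ y.1 y.2 rfl)

lemma relDist_anti {B : Finset V} (hB : (Z.induce (B : Set V)).Connected) (h : B ⊆ G)
    {x y : V} (hx : x ∈ B) (hy : y ∈ B) : relDist Z G x y ≤ relDist Z B x y := by
  refine SimpleGraph.Reachable.dist_anti (fun a b hab => ?_) (reachable_spanningCoe hB hx hy)
  rw [adj_spanningCoe_induce] at hab ⊢
  exact ⟨hab.1, h hab.2.1, h hab.2.2⟩

lemma dist_le_relDist (hG : (Z.induce (G : Set V)).Connected)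
    {x y : V} (hx : x ∈ G) (hy : y ∈ G) : Z.dist x y ≤ relDist Z G x y :=
  SimpleGraph.Reachable.dist_anti (fun _ _ hab => (adj_spanningCoe_induce.1 hab).1)
    (reachable_spanningCoe hG hx hy)

/-- Relative balls are no larger than balls of the whole graph. -/
lemma card_relBall_le {C d : ℝ} (hC : 0 ≤ C) (hd : 0 ≤ d) (hZ : PolynomialGrowth Z C d)
    (hG : (Z.induce (G : Set V)).Connected) {u : V} (hu : u ∈ G) {L : ℝ} (hL : 1 ≤ L) :
    ((relBall Z G u L).card : ℝ) ≤ C * L ^ d := by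
  have hL0 : 0 ≤ L := by linarith
  have h1 : 1 ≤ ⌊L⌋₊ := Nat.one_le_floor_iff _ |>.2 hL
  obtain ⟨hfin, hcard⟩ := hZ u ⌊L⌋₊ h1
  have hsub : (relBall Z G u L : Set V) ⊆ {y : V | Z.dist u y ≤ ⌊L⌋₊} := by
    intro y hy
    obtain ⟨hyG, hy⟩ := mem_relBall.1 (Finset.mem_coe.1 hy)
    exact (dist_le_relDist hG hu hyG).trans (Nat.le_floor hy)
  have h2 : ((relBall Z G u L).card : ℝ) ≤ ({y : V | Z.dist u y ≤ ⌊L⌋₊}.ncard : ℝ) := by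
    rw [← Set.ncard_coe_finset]
    exact_mod_cast Set.ncard_le_ncard hsub hfin
  refine h2.trans (hcard.trans ?_)
  gcongr
  exact Nat.floor_le hL0

/-- The degrees are bounded by the growth constant. -/
lemma card_le_of_forall_adj {C d : ℝ} (hZ : PolynomialGrowth Z C d) (z : V) (s : Finset V)
    (hs : ∀ z' ∈ s, Z.Adj z z') : (s.card : ℝ) ≤ C := by
  obtain ⟨hfin, hcard⟩ := hZ z 1 le_rfl
  have hsub : (s : Set V) ⊆ {y : V | Z.dist z y ≤ 1} := fun y hy =>
    (SimpleGraph.dist_eq_one_iff_adj.2 (hs y hy)).le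
  have h2 : (s.card : ℝ) ≤ ({y : V | Z.dist z y ≤ 1}.ncard : ℝ) := by
    rw [← Set.ncard_coe_finset]
    exact_mod_cast Set.ncard_le_ncard hsub hfin
  simpa using h2.trans hcard

end

section

/-! ### Symmetric matrices and rank-one perturbations -/

section LinearAlgebra

open Matrix

variable {n : Type*} [Fintype n] [DecidableEq n]

/-- The spectral theorem for real symmetric matrices, with the orthogonal matrix and its
transpose spelled out. -/
lemma exists_orthogonal_diagonalization {A : Matrix n n ℝ} (hA : A.IsHermitian) :
    ∃ (U : Matrix n n ℝ) (l : n → ℝ), U * Uᵀ = 1 ∧ Uᵀ * U = 1 ∧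
      spectrum ℝ A = Set.range l ∧ A = U * diagonal l * Uᵀ := by
  have hU := hA.eigenvectorUnitary.2
  rw [mem_unitaryGroup_iff] at hU
  have hU' := hA.eigenvectorUnitary.2
  rw [mem_unitaryGroup_iff'] at hU'
  refine ⟨hA.eigenvectorUnitary, hA.eigenvalues, ?_, ?_, hA.spectrum_real_eq_range_eigenvalues, ?_⟩
  · simpa [star_eq_conjTranspose] using hU
  · simpa [star_eq_conjTranspose] using hU'
  · have h := hA.spectral_theorem
    rw [Unitary.conjStarAlgAut_apply] at h
    simpa [star_eq_conjTranspose, Function.comp_def] using h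

lemma inv_sub_smul_of_diagonalization {K : Type*} [Field K] {U : Matrix n n K} {l : n → K}
    (h1 : U * Uᵀ = 1) (h2 : Uᵀ * U = 1) {z : K} (hz : ∀ i, l i ≠ z) :
    (U * diagonal l * Uᵀ - z • (1 : Matrix n n K))⁻¹
      = U * diagonal (fun i => (l i - z)⁻¹) * Uᵀ := by
  apply inv_eq_right_inv
  have h3 : U * diagonal l * Uᵀ - z • (1 : Matrix n n K)
      = U * diagonal (fun i => l i - z) * Uᵀ := by
    have : diagonal (fun i => l i - z) = diagonal l - z • (1 : Matrix n n K) := by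
      rw [smul_one_eq_diagonal, diagonal_sub]
    rw [this, mul_sub, sub_mul, Matrix.mul_smul, Matrix.smul_mul, mul_one, h1]
  calc _ = U * diagonal (fun i => l i - z) * (Uᵀ * U) * diagonal (fun i => (l i - z)⁻¹) * Uᵀ := by
        rw [h3]; simp only [mul_assoc]
    _ = U * (diagonal (fun i => l i - z) * diagonal (fun i => (l i - z)⁻¹)) * Uᵀ := by
        rw [h2]; simp only [mul_assoc, mul_one]
    _ = 1 := by
        rw [diagonal_mul_diagonal]
        have : (fun i => (l i - z) * (l i - z)⁻¹) = fun _ => (1 : K) := by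
          ext i
          exact mul_inv_cancel₀ (sub_ne_zero.2 (hz i))
        rw [this, diagonal_one, mul_one, h1]

/-- The entries of the resolvent are bounded by the inverse distance to the spectrum. -/
lemma abs_inv_sub_smul_apply_le {A : Matrix n n ℝ} (hA : A.IsHermitian) {E δ : ℝ} (hδ : 0 < δ)
    (h : ∀ t ∈ spectrum ℝ A, δ ≤ |t - E|) (x y : n) :
    |(A - E • (1 : Matrix n n ℝ))⁻¹ x y| ≤ δ⁻¹ := by
  obtain ⟨U, l, h1, h2, hs, hAU⟩ := exists_orthogonal_diagonalization hA
  have hl : ∀ i, δ ≤ |l i - E| := fun i => h _ (hs ▸ Set.mem_range_self i)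
  have hz : ∀ i, l i ≠ E := fun i hi => by
    have := hl i
    rw [hi, sub_self, abs_zero] at this
    linarith
  have hrow : ∀ x, ∑ i, U x i ^ 2 = 1 := fun x => by
    have := congrFun (congrFun h1 x) x
    simpa [mul_apply, sq] using this
  have hexp : (A - E • (1 : Matrix n n ℝ))⁻¹ x y = ∑ i, U x i * (l i - E)⁻¹ * U y i := by
    rw [hAU, inv_sub_smul_of_diagonalization h1 h2 hz, mul_apply]
    simp [mul_diagonal]
  rw [hexp]
  calc |∑ i, U x i * (l i - E)⁻¹ * U y i| ≤ ∑ i, |U x i * (l i - E)⁻¹ * U y i| :=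
        Finset.abs_sum_le_sum_abs _ _
    _ ≤ ∑ i, δ⁻¹ * ((U x i ^ 2 + U y i ^ 2) / 2) := by
        refine Finset.sum_le_sum fun i _ => ?_
        rw [abs_mul, abs_mul, abs_inv]
        have h3 : |l i - E|⁻¹ ≤ δ⁻¹ := inv_anti₀ hδ (hl i)
        have h4 : |U x i| * |U y i| ≤ (U x i ^ 2 + U y i ^ 2) / 2 := by
          nlinarith [sq_nonneg (|U x i| - |U y i|), sq_abs (U x i), sq_abs (U y i)]
        calc |U x i| * |l i - E|⁻¹ * |U y i| = |l i - E|⁻¹ * (|U x i| * |U y i|) := by ring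
          _ ≤ _ := by gcongr
    _ = δ⁻¹ := by
        rw [← Finset.mul_sum, ← Finset.sum_div, Finset.sum_add_distrib, hrow, hrow]
        norm_num

/-- If `A` has an eigenvalue within `ε` of `E`, then a diagonal entry of the resolvent at the
complex energy `E + iε` is large: the imaginary parts of the summands of the trace
`∑ (λᵢ - E - iε)⁻¹` are positive, so nothing cancels. -/
lemma exists_le_norm_inv_apply_self {A : Matrix n n ℝ} (hA : A.IsHermitian) {E ε t : ℝ}
    (hε : 0 < ε) (ht : t ∈ spectrum ℝ A) (hE : |t - E| ≤ ε) :
    ∃ x : n, (2 * ε * Fintype.card n)⁻¹ ≤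
      ‖((A.map (algebraMap ℝ ℂ) - (E + ε * Complex.I : ℂ) • (1 : Matrix n n ℂ))⁻¹) x x‖ := by
  obtain ⟨U, l, h1, h2, hs, hAU⟩ := exists_orthogonal_diagonalization hA
  obtain ⟨i₀, rfl⟩ : t ∈ Set.range l := hs ▸ ht
  set f : ℝ →+* ℂ := algebraMap ℝ ℂ
  have h1' : U.map f * (U.map f)ᵀ = 1 := by
    rw [← transpose_map, ← Matrix.map_mul, h1, Matrix.map_one _ (map_zero f) (map_one f)]
  have h2' : (U.map f)ᵀ * U.map f = 1 := by
    rw [← transpose_map, ← Matrix.map_mul, h2, Matrix.map_one _ (map_zero f) (map_one f)]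
  have hA' : A.map f = U.map f * diagonal (fun i => (l i : ℂ)) * (U.map f)ᵀ := by
    conv_lhs => rw [hAU]
    rw [Matrix.map_mul, Matrix.map_mul, diagonal_map (map_zero f), transpose_map]
    rfl
  set z : ℂ := E + ε * Complex.I
  have hz : ∀ i, (l i : ℂ) ≠ z := fun i hi => by
    have := congrArg Complex.im hi
    simp [z] at this
    exact hε.ne this
  set M := (A.map f - z • (1 : Matrix n n ℂ))⁻¹ with hM
  have htr : M.trace = ∑ i, ((l i : ℂ) - z)⁻¹ := by
    rw [hM, hA', inv_sub_smul_of_diagonalization h1' h2' hz, trace_mul_comm, ← mul_assoc, h2',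
      one_mul, trace_diagonal]
  have him : ∀ i, (((l i : ℂ) - z)⁻¹).im = ε / ((l i - E) ^ 2 + ε ^ 2) := fun i => by
    rw [Complex.inv_im]
    simp [z, Complex.normSq_apply, sq]
  have hlow : (2 * ε)⁻¹ ≤ ‖M.trace‖ := by
    refine le_trans ?_ ((le_abs_self _).trans (Complex.abs_im_le_norm _))
    rw [htr, Complex.im_sum]
    refine le_trans ?_ (Finset.single_le_sum (f := fun i => (((l i : ℂ) - z)⁻¹).im)
      (fun i _ => ?_) (Finset.mem_univ i₀))
    · simp only [him]
      have : (l i₀ - E) ^ 2 ≤ ε ^ 2 := sq_le_sq' (by linarith [(abs_le.1 hE).1]) (abs_le.1 hE).2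
      rw [inv_eq_one_div, div_le_div_iff₀ (by positivity) (by positivity)]
      nlinarith
    · simp only [him]
      positivity
  by_contra! hcon
  have : Nonempty n := ⟨i₀⟩
  have hn : (0 : ℝ) < Fintype.card n := by exact_mod_cast Fintype.card_pos
  have : ‖M.trace‖ < (2 * ε)⁻¹ := by
    calc ‖M.trace‖ ≤ ∑ x, ‖M x x‖ := norm_sum_le _ _
      _ < ∑ _x : n, (2 * ε * Fintype.card n)⁻¹ :=
          Finset.sum_lt_sum_of_nonempty Finset.univ_nonempty fun x _ => hcon x
      _ = (2 * ε)⁻¹ := by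
          rw [Finset.sum_const, Finset.card_univ, nsmul_eq_mul]
          field_simp
  linarith

/-- By Cramer's rule a diagonal entry of the inverse is `c / (e + t c)` as a function of the
diagonal entry `t` of the matrix, so it can only be large for `t` in a short interval. -/
lemma abs_add_re_det_div_adjugate_le {M : Matrix n n ℂ} {x : n} {t r : ℝ} (hr : 0 < r)
    (h : r ≤ ‖(M.updateRow x (M x + (t : ℂ) • Pi.single x 1))⁻¹ x x‖) :
    |t + (M.det / M.adjugate x x).re| ≤ r⁻¹ := by
  have hdet : (M.updateRow x (M x + (t : ℂ) • Pi.single x 1)).det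
      = M.det + t * M.adjugate x x := by
    rw [det_updateRow_add, updateRow_eq_self, det_updateRow_smul, adjugate_apply]
  have hadj : (M.updateRow x (M x + (t : ℂ) • Pi.single x 1)).adjugate x x = M.adjugate x x := by
    rw [adjugate_apply, updateRow_idem, adjugate_apply]
  rw [inv_def, Matrix.smul_apply, hdet, hadj, smul_eq_mul, Ring.inverse_eq_inv', norm_mul,
    norm_inv] at h
  set c := M.adjugate x x
  have hc : c ≠ 0 := by
    rintro hc
    rw [hc, norm_zero, mul_zero] at h
    linarith
  have hc' : 0 < ‖c‖ := norm_pos_iff.2 hc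
  have hfac : M.det + t * c = ((t : ℂ) + M.det / c) * c := by
    field_simp
    ring
  rw [hfac, norm_mul, mul_inv, mul_assoc, inv_mul_cancel₀ hc'.ne', mul_one] at h
  have h2 : ‖(t : ℂ) + M.det / c‖ ≤ r⁻¹ := by
    have := inv_anti₀ hr h
    rwa [inv_inv] at this
  refine le_trans ?_ h2
  refine le_trans (le_of_eq ?_) (Complex.abs_re_le_norm _)
  simp

end LinearAlgebra

variable {V : Type u} {Z : SimpleGraph V} {v : V → ℝ} {E : ℝ}

/-! ### Green functions of finite sets -/

lemma schrodinger_symm (x y : V) : schrodinger Z v x y = schrodinger Z v y x := by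
  classical
  simp only [schrodinger, Matrix.of_apply, SimpleGraph.adj_comm _ x y]
  by_cases h : x = y
  · subst h; rfl
  · simp [h, Ne.symm h]

lemma dirichlet_isHermitian (Λ : Finset V) : (dirichlet Z v Λ).IsHermitian := by
  ext x y
  simpa [dirichlet] using schrodinger_symm _ _

open Classical in
lemma notMem_spec_iff {Λ : Finset V} :
    E ∉ spec Z v Λ ↔ (dirichlet Z v Λ - E • (1 : Matrix Λ Λ ℝ)).det ≠ 0 := by
  rw [spec, spectrum.notMem_iff, ← IsUnit.neg_iff, neg_sub, Matrix.isUnit_iff_isUnit_det,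
    isUnit_iff_ne_zero, Algebra.algebraMap_eq_smul_one]

open Classical in
lemma green_symm (Λ : Finset V) (x y : Λ) : green Z v Λ E x y = green Z v Λ E y x := by
  have h : (dirichlet Z v Λ - E • (1 : Matrix Λ Λ ℝ)).transpose
      = dirichlet Z v Λ - E • (1 : Matrix Λ Λ ℝ) := by
    have := (dirichlet_isHermitian (Z := Z) (v := v) Λ).eq
    rw [Matrix.conjTranspose_eq_transpose_of_trivial] at this
    rw [Matrix.transpose_sub, this, Matrix.transpose_smul, Matrix.transpose_one]
  unfold green
  conv_lhs => rw [← h, ← Matrix.transpose_nonsing_inv]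
  rfl

open Classical in
/-- The geometric resolvent identity: a solution on `B` of `(H - E) g = 0` inside `b ⊆ B` is
recovered from its values just outside `b` through the Green function of `b`. -/
lemma eq_sum_green_mul {b B : Finset V} (hbB : b ⊆ B) (hE : E ∉ spec Z v b) {g : V → ℝ}
    (hg : ∀ z ∈ b, ∑ z' ∈ B, schrodinger Z v z z' * g z' = E * g z) (x : b) :
    g x = ∑ z : b, green Z v b E x z * ∑ z' ∈ (B \ b) with Z.Adj z z', g z' := by
  have hdet := notMem_spec_iff.1 hE
  set A := dirichlet Z v b - E • (1 : Matrix b b ℝ) with hA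
  have hkey : A.mulVec (fun z : b => g z)
      = fun z : b => ∑ z' ∈ (B \ b) with Z.Adj z z', g z' := by
    ext z
    have h1 := hg z z.2
    rw [← Finset.sum_sdiff hbB] at h1
    have h2 : ∑ z' ∈ B \ b, schrodinger Z v z z' * g z'
        = - ∑ z' ∈ (B \ b) with Z.Adj z z', g z' := by
      rw [Finset.sum_filter, ← Finset.sum_neg_distrib]
      refine Finset.sum_congr rfl fun z' hz' => ?_
      have hne : (z : V) ≠ z' := fun h => (Finset.mem_sdiff.1 hz').2 (h ▸ z.2)
      by_cases hadj : Z.Adj z z' <;> simp [schrodinger, hne, hadj]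
    have h3 : (dirichlet Z v b).mulVec (fun z : b => g z) z
        = ∑ z' ∈ b, schrodinger Z v z z' * g z' := by
      rw [Matrix.mulVec, dotProduct, ← Finset.sum_coe_sort b]
      rfl
    rw [hA, Matrix.sub_mulVec, Pi.sub_apply, h3, Matrix.smul_mulVec, Matrix.one_mulVec]
    simp only [Pi.smul_apply, smul_eq_mul]
    linarith
  have hsol : (fun z : b => g z)
      = A⁻¹.mulVec (fun z : b => ∑ z' ∈ (B \ b) with Z.Adj z z', g z') := by
    rw [← hkey, Matrix.mulVec_mulVec, Matrix.nonsing_inv_mul _ (isUnit_iff_ne_zero.2 hdet),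
      Matrix.one_mulVec]
  exact congrFun hsol x

open Classical in
/-- The Green function of `Λ` with second argument `y`, extended by zero. -/
noncomputable def greenCol (Z : SimpleGraph V) (v : V → ℝ) (Λ : Finset V) (E : ℝ) (y : Λ)
    (z : V) : ℝ :=
  if h : z ∈ Λ then green Z v Λ E ⟨z, h⟩ y else 0

lemma greenCol_apply {Λ : Finset V} {y : Λ} (z : Λ) :
    greenCol Z v Λ E y z = green Z v Λ E z y := by
  simp [greenCol]

lemma sum_schrodinger_mul_greenCol {B : Finset V} (hE : E ∉ spec Z v B) (y : B) {z : V}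
    (hz : z ∈ B) (hzy : z ≠ y) :
    ∑ z' ∈ B, schrodinger Z v z z' * greenCol Z v B E y z' = E * greenCol Z v B E y z := by
  classical
  have hdet := notMem_spec_iff.1 hE
  have h1 := congrFun (congrFun (Matrix.mul_nonsing_inv _ (isUnit_iff_ne_zero.2 hdet)) ⟨z, hz⟩) y
  rw [sub_mul, Matrix.sub_apply, Matrix.smul_mul, Matrix.one_mul, Matrix.smul_apply,
    Matrix.one_apply_ne (by simpa [Subtype.ext_iff] using hzy), Matrix.mul_apply] at h1
  rw [← Finset.sum_coe_sort B]
  have h2 : greenCol Z v B E y z = green Z v B E ⟨z, hz⟩ y := greenCol_apply ⟨z, hz⟩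
  simp only [greenCol_apply, h2]
  exact sub_eq_zero.1 h1

open Classical in
lemma abs_green_le {Λ : Finset V} {δ : ℝ} (hδ : 0 < δ) (h : δ ≤ Metric.infDist E (spec Z v Λ))
    (x y : Λ) : |green Z v Λ E x y| ≤ δ⁻¹ := by
  refine abs_inv_sub_smul_apply_le (dirichlet_isHermitian Λ) hδ (fun t ht => ?_) x y
  rw [abs_sub_comm, ← Real.dist_eq]
  exact h.trans (Metric.infDist_le_dist_of_mem ht)

end

section

variable {V : Type u} {Z : SimpleGraph V} {v : V → ℝ} {E : ℝ}

/-! ### Decay by iteration -/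

/-- If `f` contracts by the factor `q` over steps of length `s` at good points, then it contracts
by `q ^ n` at a point all of whose surroundings, up to distance `(n - 1) s`, are good. -/
lemma le_pow_mul_of_step {ρ : V → V → ℕ} {B : Finset V}
    (htri : ∀ x ∈ B, ∀ y ∈ B, ∀ z ∈ B, ρ x z ≤ ρ x y + ρ y z) (hself : ∀ x, ρ x x = 0)
    {f : V → ℝ} {good : V → Prop} {s : ℕ} {q : ℝ}
    (hstep : ∀ w ∈ B, good w → ∀ M, (∀ z ∈ B, ρ w z ≤ s → f z ≤ M) → f w ≤ q * M) (n : ℕ) :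
    ∀ x ∈ B, (∀ w ∈ B, ρ x w + s ≤ n * s → good w) →
      ∀ M, (∀ z ∈ B, ρ x z ≤ n * s → f z ≤ M) → f x ≤ q ^ n * M := by
  induction n with
  | zero =>
    intro x hx _ M hM
    simpa using hM x hx (by simp [hself])
  | succ n ih =>
    intro x hx hgood M hM
    have hx' : good x := hgood x hx (by rw [hself, Nat.succ_mul]; omega)
    rw [pow_succ', mul_assoc]
    refine hstep x hx hx' _ fun z hz hxz => ih z hz (fun w hw hzw => ?_) M fun z' hz' hzz' => ?_
    · have := htri x hx z hz w hw
      exact hgood w hw (by rw [Nat.succ_mul]; omega)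
    · have := htri x hx z hz z' hz'
      exact hM z' hz' (by rw [Nat.succ_mul]; omega)

/-- Two-sided iteration: if the bad points lie in one ball of radius less than `2 s`, the steps
from `x` and the steps from `y` that avoid this ball together cover the distance between `x` and
`y` up to a bounded number of steps. -/
lemma le_pow_mul_of_bad_cluster {ρ : V → V → ℕ} {B : Finset V}
    (htri : ∀ x ∈ B, ∀ y ∈ B, ∀ z ∈ B, ρ x z ≤ ρ x y + ρ y z) (hself : ∀ x, ρ x x = 0)
    (hcomm : ∀ x y, ρ x y = ρ y x)
    {F : V → V → ℝ} (hF : ∀ x ∈ B, ∀ y ∈ B, F x y = F y x) {bad : V → Prop} {s : ℕ} (hs : 0 < s)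
    {q M : ℝ} (hM : ∀ x ∈ B, ∀ y ∈ B, F x y ≤ M)
    (hstep : ∀ y ∈ B, ∀ w ∈ B, ¬ bad w → s ≤ ρ w y →
      ∀ M, (∀ z ∈ B, ρ w z ≤ s → F z y ≤ M) → F w y ≤ q * M)
    {w₀ : V} (hw₀ : w₀ ∈ B) (hbad : ∀ w ∈ B, bad w → ρ w₀ w < 2 * s)
    {x y : V} (hx : x ∈ B) (hy : y ∈ B) : F x y ≤ q ^ (ρ x y / s - 3) * M := by
  set R := ρ x y with hR
  set N := R / s - 3 with hN
  -- `n` steps from `x`, as many as the bad ball permits, and the remaining `n'` from `y`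
  set n := min N (ρ x w₀ / s - 1) with hn
  obtain ⟨n', hn'⟩ : ∃ n', N = n + n' := ⟨N - n, by omega⟩
  have e1 : R / s * s ≤ R := Nat.div_mul_le_self _ _
  have e2 : ρ x w₀ / s * s ≤ ρ x w₀ := Nat.div_mul_le_self _ _
  have e3 : ρ x w₀ < (ρ x w₀ / s + 1) * s := by
    rw [Nat.succ_mul]
    exact Nat.lt_div_mul_add hs
  have htri₀ : R ≤ ρ x w₀ + ρ y w₀ := by
    have := htri x hx w₀ hw₀ y hy
    rw [hcomm w₀ y] at this
    exact this
  have hNR : 1 ≤ N → (N + 3) * s ≤ R := fun h => by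
    have : N + 3 = R / s := by omega
    rwa [this]
  -- a start at distance `(n + 1) s` or more from `w₀` leaves room for `n` steps
  have hnx : 1 ≤ n → (n + 1) * s ≤ ρ x w₀ := fun h => by
    have : n + 1 ≤ ρ x w₀ / s := by omega
    exact (Nat.mul_le_mul_right s this).trans e2
  have hny : 1 ≤ n' → (n' + 1) * s ≤ ρ y w₀ := fun h => by
    have h1 : ρ x w₀ / s + 1 ≤ n + 2 := by omega
    have h2 := Nat.mul_le_mul_right s h1
    have h3 := hNR (by omega)
    rw [hn'] at h3
    have h4 : (n + n' + 3) * s = (n' + 1) * s + (n + 2) * s := by ring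
    omega
  have hfirst : ∀ x' ∈ B, ρ x x' ≤ n * s → F x' y ≤ q ^ n' * M := fun x' hx' hxx' => by
    rw [hF x' hx' y hy]
    refine le_pow_mul_of_step (f := fun z => F z x') (good := fun w => ¬ bad w ∧ s ≤ ρ w x')
      htri hself (fun w hw hgood M hz => hstep x' hx' w hw hgood.1 hgood.2 M hz) n' y hy
      (fun w hw hyw => ?_) M (fun z hz _ => hM z hz x' hx')
    have h1 : 1 ≤ n' := by
      rcases Nat.eq_zero_or_pos n' with h | h
      · rw [h] at hyw; omega
      · exact h
    constructor
    · intro hb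
      have h2 := hbad w hw hb
      have h3 := htri y hy w hw w₀ hw₀
      have h4 := hny h1
      rw [hcomm w w₀] at h3
      rw [Nat.succ_mul] at h4
      omega
    · have h2 := htri x hx x' hx' y hy
      have h3 := htri x' hx' w hw y hy
      have h4 := hNR (by omega)
      rw [hcomm w y, hcomm x' w] at h3
      rw [hn'] at h4
      have h5 : (n + n' + 3) * s = n * s + n' * s + 3 * s := by ring
      omega
  rw [hn', pow_add, mul_assoc]
  refine le_pow_mul_of_step (f := fun z => F z y) (good := fun w => ¬ bad w ∧ s ≤ ρ w y)
    htri hself (fun w hw hgood M hz => hstep y hy w hw hgood.1 hgood.2 M hz) n x hx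
    (fun w hw hxw => ?_) (q ^ n' * M) hfirst
  have h1 : 1 ≤ n := by
    rcases Nat.eq_zero_or_pos n with h | h
    · rw [h] at hxw; omega
    · exact h
  constructor
  · intro hb
    have h2 := hbad w hw hb
    have h3 := htri x hx w hw w₀ hw₀
    have h4 := hnx h1
    rw [hcomm w w₀] at h3
    rw [Nat.succ_mul] at h4
    omega
  · have h3 := htri x hx w hw y hy
    have h4 := hNR (by omega)
    rw [hn'] at h4
    have h5 : (n + n' + 3) * s = n * s + n' * s + 3 * s := by ring
    omega

/-! ### Green functions of balls with one cluster of singular balls -/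

/-- One step of the iteration: a nonsingular ball of radius `l` about `w` makes the Green function
at `w` smaller than its maximum at distance `⌊l⌋ + 1`. The factor `C² l ^ d` in the definition of
nonsingularity pays for the number of boundary edges of the ball. -/
lemma abs_greenCol_le_of_nonsingular {p : Params} (hC : 0 < p.C) (hd : 0 ≤ p.d)
    (hZ : PolynomialGrowth Z p.C p.d)
    {B : Finset V} (hB : (Z.induce (B : Set V)).Connected) (hE : E ∉ spec Z v B) {l m : ℝ}
    (hl : 1 ≤ l) (hls : l ^ ((1 + p.ϱ) / p.α) ≤ (⌊l⌋₊ : ℝ)) (y : B) {w : V} (hw : w ∈ B)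
    (hns : Nonsingular p Z v E m B w l) (hwy : ⌊l⌋₊ + 1 ≤ relDist Z B w y) {M : ℝ}
    (hM : ∀ z ∈ B, relDist Z B w z ≤ ⌊l⌋₊ + 1 → |greenCol Z v B E y z| ≤ M) :
    |greenCol Z v B E y w| ≤ Real.exp (-(gam p m l * ⌊l⌋₊)) * M := by
  classical
  have hl0 : 0 < l := by linarith
  set b := relBall Z B w l with hb
  have hmem : ∀ {z}, z ∈ b ↔ z ∈ B ∧ relDist Z B w z ≤ ⌊l⌋₊ := fun {z} => by
    rw [hb, mem_relBall, Nat.le_floor_iff hl0.le]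
  have hM0 : 0 ≤ M := (abs_nonneg _).trans (hM w hw (by simp))
  have hg : ∀ z ∈ b, ∑ z' ∈ B, schrodinger Z v z z' * greenCol Z v B E y z'
      = E * greenCol Z v B E y z := fun z hz => by
    refine sum_schrodinger_mul_greenCol hE y (hmem.1 hz).1 ?_
    rintro rfl
    have := (hmem.1 hz).2
    omega
  have hwb : w ∈ b := hmem.2 ⟨hw, by simp⟩
  have hid := eq_sum_green_mul (relBall_subset w l) hns.1 hg ⟨w, hwb⟩
  change greenCol Z v B E y w = _ at hid
  rw [hid]
  have hdec := hns.2
  set K : ℝ := p.C ^ 2 * l ^ p.d with hK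
  have hKpos : 0 < K := by positivity
  have hterm : ∀ z : b, |green Z v b E ⟨w, hwb⟩ z *
      ∑ z' ∈ (B \ b) with Z.Adj z z', greenCol Z v B E y z'|
        ≤ Real.exp (-(gam p m l * ⌊l⌋₊)) / K * (p.C * M) := fun z => by
    rw [abs_mul]
    rcases ((B \ b).filter fun z' => Z.Adj z z').eq_empty_or_nonempty with h | ⟨z', hz'⟩
    · rw [h, Finset.sum_empty, abs_zero, mul_zero]
      positivity
    · -- a point with a neighbour outside the ball is at distance exactly `⌊l⌋` from the centre
      have hz : relDist Z B w z = ⌊l⌋₊ := by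
        refine le_antisymm (hmem.1 z.2).2 ?_
        rw [Finset.mem_filter, Finset.mem_sdiff] at hz'
        have h1 : ⌊l⌋₊ < relDist Z B w z' := by
          by_contra! hcon
          exact hz'.1.2 (hmem.2 ⟨hz'.1.1, hcon⟩)
        have h2 := relDist_triangle hB hw (hmem.1 z.2).1 z'
        have h3 := relDist_le_one_of_adj (hmem.1 z.2).1 hz'.1.1 hz'.2
        omega
      have h1 : |green Z v b E ⟨w, hwb⟩ z| ≤ Real.exp (-(gam p m l * ⌊l⌋₊)) / K := by
        have := hdec ⟨w, hwb⟩ z (by simpa only [hz] using hls)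
        rw [le_div_iff₀ hKpos, mul_comm]
        simpa only [hz] using this
      have h2 : |∑ z' ∈ (B \ b) with Z.Adj z z', greenCol Z v B E y z'| ≤ p.C * M := by
        refine (Finset.abs_sum_le_sum_abs _ _).trans
          ((Finset.sum_le_card_nsmul _ _ M fun z' hz' => ?_).trans ?_)
        · rw [Finset.mem_filter, Finset.mem_sdiff] at hz'
          have h2 := relDist_triangle hB hw (hmem.1 z.2).1 z'
          have h3 := relDist_le_one_of_adj (hmem.1 z.2).1 hz'.1.1 hz'.2
          exact hM z' hz'.1.1 (by omega)
        · rw [nsmul_eq_mul]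
          exact mul_le_mul_of_nonneg_right
            (card_le_of_forall_adj hZ z _ fun z' hz' => (Finset.mem_filter.1 hz').2) hM0
      gcongr
  have hcard : (b.card : ℝ) ≤ p.C * l ^ p.d := card_relBall_le hC.le hd hZ hB hw hl
  calc _ ≤ ∑ z : b, |green Z v b E ⟨w, hwb⟩ z *
            ∑ z' ∈ (B \ b) with Z.Adj z z', greenCol Z v B E y z'| :=
        Finset.abs_sum_le_sum_abs _ _
    _ ≤ ∑ _z : b, Real.exp (-(gam p m l * ⌊l⌋₊)) / K * (p.C * M) :=
        Finset.sum_le_sum fun z _ => hterm z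
    _ = b.card * (Real.exp (-(gam p m l * ⌊l⌋₊)) / K * (p.C * M)) := by
        rw [Finset.sum_const, Finset.card_univ, Fintype.card_coe, nsmul_eq_mul]
    _ ≤ (p.C * l ^ p.d) * (Real.exp (-(gam p m l * ⌊l⌋₊)) / K * (p.C * M)) := by
        gcongr
    _ = Real.exp (-(gam p m l * ⌊l⌋₊)) * M := by
        rw [hK]
        field_simp

/-- If the singular balls of radius `l` inside `B` pairwise intersect, the Green function of `B`
decays exponentially, up to the a priori bound given by the distance from `E` to the spectrum. -/
lemma abs_green_le_of_pairwise_intersect {p : Params} (hC : 0 < p.C) (hd : 0 ≤ p.d)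
    (hZ : PolynomialGrowth Z p.C p.d)
    {B : Finset V} (hB : (Z.induce (B : Set V)).Connected) {l m δ : ℝ} (hδ : 0 < δ)
    (hE : δ ≤ Metric.infDist E (spec Z v B))
    (hl : 1 ≤ l) (hls : l ^ ((1 + p.ϱ) / p.α) ≤ (⌊l⌋₊ : ℝ))
    (hsing : ∀ w ∈ B, ∀ w' ∈ B, ¬ Nonsingular p Z v E m B w l → ¬ Nonsingular p Z v E m B w' l →
      ¬ Disjoint (relBall Z B w l) (relBall Z B w' l)) (x y : B) :
    |green Z v B E x y|
      ≤ Real.exp (-(gam p m l * ⌊l⌋₊)) ^ (relDist Z B x y / (⌊l⌋₊ + 1) - 3) * δ⁻¹ := by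
  have hl0 : 0 ≤ l := by linarith
  have hEs : E ∉ spec Z v B := fun h => by
    rw [Metric.infDist_zero_of_mem h] at hE
    linarith
  -- all singular centres lie within `2 l` of any one of them
  obtain ⟨w₀, hw₀, hbad⟩ : ∃ w₀ ∈ B, ∀ w ∈ B, ¬ Nonsingular p Z v E m B w l →
      relDist Z B w₀ w < 2 * (⌊l⌋₊ + 1) := by
    by_cases h : ∃ w₀ ∈ B, ¬ Nonsingular p Z v E m B w₀ l
    · obtain ⟨w₀, hw₀, hs₀⟩ := h
      refine ⟨w₀, hw₀, fun w hw hs => ?_⟩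
      obtain ⟨z, hz, hz'⟩ := Finset.not_disjoint_iff.1 (hsing w₀ hw₀ w hw hs₀ hs)
      obtain ⟨hzB, hz⟩ := mem_relBall.1 hz
      obtain ⟨-, hz'⟩ := mem_relBall.1 hz'
      rw [← Nat.le_floor_iff hl0] at hz hz'
      have := relDist_triangle hB hw₀ hzB w
      rw [relDist_comm z w] at this
      omega
    · push Not at h
      exact ⟨x, x.2, fun w hw hs => absurd (h w hw) hs⟩
  classical
  set F : V → V → ℝ := fun a c => if h : c ∈ B then |greenCol Z v B E ⟨c, h⟩ a| else 0 with hF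
  have hFapp : ∀ a c : B, F a c = |green Z v B E a c| := fun a c => by
    simp [hF, greenCol_apply]
  have hmain := le_pow_mul_of_bad_cluster (V := V) (ρ := relDist Z B) (B := B) (F := F)
    (bad := fun w => ¬ Nonsingular p Z v E m B w l)
    (s := ⌊l⌋₊ + 1) (q := Real.exp (-(gam p m l * ⌊l⌋₊))) (M := δ⁻¹)
    (fun a ha c hc e _ => relDist_triangle hB ha hc e) relDist_self relDist_comm
    (fun a ha c hc => by
      rw [hFapp ⟨a, ha⟩ ⟨c, hc⟩, hFapp ⟨c, hc⟩ ⟨a, ha⟩, green_symm])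
    (Nat.succ_pos _)
    (fun a ha c hc => by
      rw [hFapp ⟨a, ha⟩ ⟨c, hc⟩]
      exact abs_green_le hδ hE _ _)
    (fun c hc w hw hgood hwc M hM => by
      have hFc : ∀ a, F a c = |greenCol Z v B E ⟨c, hc⟩ a| := fun a => by simp [hF, hc]
      rw [hFc]
      refine abs_greenCol_le_of_nonsingular hC hd hZ hB hEs hl hls ⟨c, hc⟩ hw (not_not.1 hgood)
        hwc fun z hz hwz => ?_
      rw [← hFc]
      exact hM z hz hwz)
    hw₀ hbad x.2 y.2
  rwa [hFapp] at hmain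

end

section

/-! ### Nonsingularity of large balls -/

lemma eventually_rpow_le_mul_rpow {a b c : ℝ} (hab : a < b) (hc : 0 < c) :
    ∀ᶠ x : ℝ in atTop, x ^ a ≤ c * x ^ b := by
  have h := (tendsto_rpow_neg_atTop (sub_pos.2 hab)).eventually (ge_mem_nhds hc)
  filter_upwards [h, eventually_gt_atTop 0] with x hx hx0
  have : x ^ a = x ^ (-(b - a)) * x ^ b := by
    rw [← Real.rpow_add hx0]
    congr 1
    ring
  rw [this]
  gcongr

lemma eventually_add_mul_log_le {a b c r : ℝ} (hr : 0 < r) (hc : 0 < c) :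
    ∀ᶠ x : ℝ in atTop, a + b * Real.log x ≤ c * x ^ r := by
  have h1 : (fun x : ℝ => a + b * Real.log x) =o[atTop] fun x : ℝ => x ^ r := by
    refine Asymptotics.IsLittleO.add ?_ ((isLittleO_log_rpow_atTop hr).const_mul_left b)
    rw [Asymptotics.isLittleO_const_left]
    exact Or.inr (tendsto_norm_atTop_atTop.comp (tendsto_rpow_atTop hr))
  filter_upwards [h1.def hc, eventually_ge_atTop 0] with x hx hx0
  rw [Real.norm_of_nonneg (Real.rpow_nonneg hx0 r)] at hx
  exact (le_abs_self _).trans hx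

/-- At large scales the steps of the iteration lose, against the full distance `R`, only a
fraction of order `l ^ (-ϱ)`. This and the a priori bound `exp (l ^ (α β))` are absorbed when the
decay rate drops from `γ(m, l)` to `γ(m, l ^ α)`. -/
lemma eventually_iterated_bound_le (p : Params) (hα₁ : 1 < p.α) (hC : 0 < p.C) (hτ : 0 < p.τ)
    (hτϱ : p.τ < p.ϱ) (hϱ : p.ϱ < p.α - 1) (hα₂ : p.α < 2)
    (hβτ : p.α * p.β + p.τ < 1 + p.ϱ)
    {m₀ : ℝ} (hm₀ : 0 < m₀) :
    ∀ᶠ l : ℝ in atTop, ∀ m, m₀ ≤ m → ∀ R : ℕ, l ^ (1 + p.ϱ) ≤ R →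
      p.C ^ 2 * (l ^ p.α) ^ p.d * (Real.exp (-(gam p m l * ⌊l⌋₊)) ^ (R / (⌊l⌋₊ + 1) - 3) *
        (Real.exp (-(l ^ p.α) ^ p.β))⁻¹) ≤ Real.exp (-(gam p m (l ^ p.α) * R)) := by
  have e1 := eventually_rpow_le_mul_rpow (a := -p.ϱ) (b := -p.τ) (c := 1 / 72) (by linarith)
    (by norm_num)
  have e2 := eventually_rpow_le_mul_rpow (a := -(p.α * p.τ)) (b := -p.τ) (c := 1 / 4)
    (by nlinarith) (by norm_num)
  have e3 := eventually_rpow_le_mul_rpow (a := p.α * p.β) (b := 1 + p.ϱ - p.τ) (c := m₀ / 4)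
    (by linarith) (by positivity)
  have e4 := eventually_add_mul_log_le (a := Real.log (p.C ^ 2)) (b := p.α * p.d) (c := m₀ / 4)
    (r := 1 + p.ϱ - p.τ) (by linarith) (by positivity)
  filter_upwards [e1, e2, e3, e4, eventually_ge_atTop 1] with l h1 h2 h3 h4 hl1 m hm R hR
  have hl0 : 0 < l := by linarith
  have hm0 : 0 < m := by linarith
  set a := l ^ (-p.τ) with ha
  set b := l ^ (-p.ϱ) with hb
  have ha0 : 0 < a := by positivity
  have hb0 : 0 < b := by positivity
  have ha1 : a ≤ 1 := Real.rpow_le_one_of_one_le_of_nonpos hl1 (by linarith)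
  have hc : (l ^ p.α) ^ (-p.τ) = l ^ (-(p.α * p.τ)) := by
    rw [← Real.rpow_mul hl0.le]
    congr 1
    ring
  set N : ℕ := R / (⌊l⌋₊ + 1) - 3 with hN
  set k : ℝ := (⌊l⌋₊ : ℝ) with hk
  have hkl : k ≤ l := Nat.floor_le hl0.le
  have hlk : l < k + 1 := Nat.lt_floor_add_one l
  have hN1 : (R : ℝ) ≤ (N + 4) * (k + 1) := by
    have : R ≤ (N + 4) * (⌊l⌋₊ + 1) := by
      have h5 := Nat.lt_div_mul_add (a := R) (Nat.succ_pos ⌊l⌋₊)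
      rw [← Nat.succ_mul] at h5
      refine h5.le.trans (Nat.mul_le_mul_right _ ?_)
      have : (⌊l⌋₊).succ = ⌊l⌋₊ + 1 := rfl
      rw [this]
      omega
    rw [hk]
    exact_mod_cast this
  have hN2 : (N : ℝ) * (k + 1) ≤ R := by
    have : N * (⌊l⌋₊ + 1) ≤ R :=
      (Nat.mul_le_mul_right _ (Nat.sub_le _ _)).trans (Nat.div_mul_le_self _ _)
    rw [hk]
    exact_mod_cast this
  have hR0 : (0 : ℝ) ≤ R := Nat.cast_nonneg _
  have hlb : l ≤ b * R := by
    calc l = b * l ^ (1 + p.ϱ) := by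
          rw [hb, ← Real.rpow_add hl0]
          simp
      _ ≤ b * R := by gcongr
  have hNb : (N : ℝ) ≤ b * R := by
    have h5 : 1 ≤ b * l := by
      rw [hb]
      nth_rewrite 2 [← Real.rpow_one l]
      rw [← Real.rpow_add hl0]
      exact Real.one_le_rpow hl1 (by linarith)
    have hN0 : (0 : ℝ) ≤ N := Nat.cast_nonneg _
    calc (N : ℝ) ≤ N * (b * l) := le_mul_of_one_le_right hN0 h5
      _ = b * (N * l) := by ring
      _ ≤ b * R := by
        gcongr
        nlinarith
  -- of `9 b`, the part `8 b` is the loss of four steps and `b` the loss of one unit per step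
  have hkN : R * (1 - 9 * b) ≤ k * N := by nlinarith
  have hA : m * (R * (1 + 3 / 4 * a)) ≤ gam p m l * k * N := by
    -- `(1 + a) * 9 * b ≤ 18 * b ≤ a / 4` by the choice of the constant `1 / 72`
    have h5 : R * (1 + 3 / 4 * a) ≤ (1 + a) * (R * (1 - 9 * b)) := by
      have : 1 + 3 / 4 * a ≤ (1 + a) * (1 - 9 * b) := by nlinarith
      calc R * (1 + 3 / 4 * a) ≤ R * ((1 + a) * (1 - 9 * b)) := by gcongr
        _ = _ := by ring
    calc m * (R * (1 + 3 / 4 * a)) ≤ m * ((1 + a) * (k * N)) :=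
          mul_le_mul_of_nonneg_left (h5.trans (by gcongr)) hm0.le
      _ = gam p m l * k * N := by
          rw [gam]
          ring
  have hB : gam p m (l ^ p.α) * R ≤ m * (R * (1 + 1 / 4 * a)) := by
    rw [gam, hc, mul_assoc, mul_comm (1 + _) (R : ℝ)]
    exact mul_le_mul_of_nonneg_left (mul_le_mul_of_nonneg_left (by linarith) hR0) hm0.le
  have hD : m₀ / 2 * l ^ (1 + p.ϱ - p.τ) ≤ m * (R * (1 / 2 * a)) := by
    have : l ^ (1 + p.ϱ - p.τ) = l ^ (1 + p.ϱ) * a := by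
      rw [ha, ← Real.rpow_add hl0]
      congr 1
    rw [this]
    calc m₀ / 2 * (l ^ (1 + p.ϱ) * a) = m₀ * (l ^ (1 + p.ϱ) * (1 / 2 * a)) := by ring
      _ ≤ _ := by gcongr
  have hβ' : (l ^ p.α) ^ p.β = l ^ (p.α * p.β) := (Real.rpow_mul hl0.le _ _).symm
  have hCl : p.C ^ 2 * (l ^ p.α) ^ p.d
      = Real.exp (Real.log (p.C ^ 2) + p.α * p.d * Real.log l) := by
    rw [Real.exp_add, Real.exp_log (by positivity), ← Real.rpow_mul hl0.le,
      Real.rpow_def_of_pos hl0]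
    ring_nf
  rw [hCl, hβ', ← Real.exp_nat_mul, ← Real.exp_neg, ← Real.exp_add, ← Real.exp_add,
    Real.exp_le_exp]
  nlinarith

lemma eventually_rpow_le_floor {r : ℝ} (hr : r < 1) :
    ∀ᶠ l : ℝ in atTop, l ^ r ≤ (⌊l⌋₊ : ℝ) := by
  filter_upwards [eventually_rpow_le_mul_rpow (c := 1 / 2) hr (by norm_num),
    eventually_ge_atTop 2] with l hl hl2
  rw [Real.rpow_one] at hl
  have := Nat.lt_floor_add_one l
  linarith

/-- A large nonresonant ball is nonsingular as soon as it does not contain two disjoint singular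
balls of the previous scale. -/
lemma eventually_nonsingular (p : Params) (hC : 0 < p.C) (hd : 0 < p.d) (hα₁ : 1 < p.α)
    (hα₂ : p.α < 2) (hτ : 0 < p.τ) (hτϱ : p.τ < p.ϱ) (hϱ : p.ϱ < p.α - 1)
    (hβτ : p.α * p.β + p.τ < 1 + p.ϱ) {m₀ : ℝ} (hm₀ : 0 < m₀) :
    ∀ᶠ l : ℝ in atTop, ∀ {V : Type u} (Z : SimpleGraph V), PolynomialGrowth Z p.C p.d →
      ∀ (v : V → ℝ) (E m : ℝ), m₀ ≤ m → ∀ (G : Finset V) (u : V),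
        (Z.induce (G : Set V)).Connected → u ∈ G → ¬ Resonant p Z v E G u (l ^ p.α) →
        (∀ w ∈ relBall Z G u (l ^ p.α), ∀ w' ∈ relBall Z G u (l ^ p.α),
          ¬ Nonsingular p Z v E m (relBall Z G u (l ^ p.α)) w l →
          ¬ Nonsingular p Z v E m (relBall Z G u (l ^ p.α)) w' l →
          ¬ Disjoint (relBall Z (relBall Z G u (l ^ p.α)) w l)
            (relBall Z (relBall Z G u (l ^ p.α)) w' l)) →
        Nonsingular p Z v E m G u (l ^ p.α) := by
  have hexp : (1 + p.ϱ) / p.α < 1 := by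
    rw [div_lt_one (by linarith)]
    linarith
  filter_upwards [eventually_iterated_bound_le p hα₁ hC hτ hτϱ hϱ hα₂ hβτ hm₀,
    eventually_rpow_le_floor hexp, eventually_ge_atTop 1]
    with l hbound hfloor hl1 V Z hZ v E m hm G u hG hu hres hsing
  have hl0 : 0 < l := by linarith
  set B := relBall Z G u (l ^ p.α) with hBdef
  have hB : (Z.induce (B : Set V)).Connected := relBall_connected hG hu (by positivity)
  have hδ : Real.exp (-(l ^ p.α) ^ p.β) ≤ Metric.infDist E (spec Z v B) := not_lt.1 hres
  have hδ0 := Real.exp_pos (-(l ^ p.α) ^ p.β)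
  refine ⟨fun h => ?_, fun x y hxy => ?_⟩
  · rw [Metric.infDist_zero_of_mem h] at hδ
    linarith
  · have hG' := abs_green_le_of_pairwise_intersect hC hd.le hZ hB hδ0 hδ hl1 hfloor hsing x y
    have hle : relDist Z G x y ≤ relDist Z B x y := relDist_anti hB (relBall_subset _ _) x.2 y.2
    have hle' : (relDist Z G x y : ℝ) ≤ relDist Z B x y := by exact_mod_cast hle
    have hR : l ^ (1 + p.ϱ) ≤ relDist Z B x y := by
      refine le_trans (le_of_eq ?_) (hxy.trans hle')
      rw [← Real.rpow_mul hl0.le, mul_div_cancel₀ _ (by linarith)]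
    calc _ ≤ p.C ^ 2 * (l ^ p.α) ^ p.d * _ := by gcongr
      _ ≤ Real.exp (-(gam p m (l ^ p.α) * relDist Z B x y)) := hbound m hm _ hR
      _ ≤ _ := by
        have hγ : 0 ≤ gam p m (l ^ p.α) := by
          have : 0 < m := by linarith
          rw [gam]
          positivity
        gcongr

end

section

/-! ### Measurability and dependence on the potential -/

section Measurability

variable {Ω : Type*} [MeasurableSpace Ω] {n : Type*} [Fintype n] [DecidableEq n]
  {K : Type*} [RCLike K]

lemma measurable_det {M : Ω → Matrix n n K} (hM : ∀ i j, Measurable fun ω => M ω i j) :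
    Measurable fun ω => (M ω).det := by
  simp only [Matrix.det_apply']
  exact Finset.measurable_sum _ fun σ _ =>
    measurable_const.mul (Finset.measurable_prod _ fun i _ => hM _ _)

lemma measurable_adjugate_apply {M : Ω → Matrix n n K} (hM : ∀ i j, Measurable fun ω => M ω i j)
    (x y : n) : Measurable fun ω => (M ω).adjugate x y := by
  simp only [Matrix.adjugate_apply]
  refine measurable_det fun i j => ?_
  by_cases h : i = y
  · subst h
    simp
  · simpa [Matrix.updateRow_ne h] using hM i j

lemma measurable_inv_apply {M : Ω → Matrix n n K} (hM : ∀ i j, Measurable fun ω => M ω i j)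
    (x y : n) : Measurable fun ω => (M ω)⁻¹ x y := by
  simp only [Matrix.inv_def, Matrix.smul_apply, Ring.inverse_eq_inv', smul_eq_mul]
  exact (measurable_det hM).inv.mul (measurable_adjugate_apply hM x y)

end Measurability

variable {V : Type u} {Z : SimpleGraph V} {E : ℝ}

lemma measurable_dirichlet_apply (Λ : Finset V) (x y : Λ) :
    Measurable fun v : V → ℝ => dirichlet Z v Λ x y := by
  classical
  simp only [dirichlet, schrodinger, Matrix.submatrix_apply, Matrix.of_apply]
  refine Measurable.sub ?_ measurable_const
  split_ifs
  · exact measurable_const.add (measurable_pi_apply _)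
  · exact measurable_const

lemma measurable_dirichlet_sub_apply [DecidableEq V] (Λ : Finset V) (x y : Λ) :
    Measurable fun v : V → ℝ => (dirichlet Z v Λ - E • (1 : Matrix Λ Λ ℝ)) x y := by
  simp only [Matrix.sub_apply]
  exact (measurable_dirichlet_apply Λ x y).sub measurable_const

lemma measurableSet_nonsingular (p : Params) (m : ℝ) (G : Finset V) (u : V) (L : ℝ) :
    MeasurableSet {v : V → ℝ | Nonsingular p Z v E m G u L} := by
  classical
  simp only [Nonsingular, Set.ofPred_and, Set.ofPred_forall, notMem_spec_iff]
  refine MeasurableSet.inter ?_ (MeasurableSet.iInter fun x => MeasurableSet.iInter fun y =>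
    MeasurableSet.iInter fun _ => measurableSet_le ?_ measurable_const)
  · exact (measurable_det fun i j => measurable_dirichlet_sub_apply _ i j)
      (measurableSet_singleton 0).compl
  · have : Measurable fun v : V → ℝ => green Z v (relBall Z G u L) E x y :=
      measurable_inv_apply (fun i j => measurable_dirichlet_sub_apply _ i j) x y
    have habs : Measurable fun v : V → ℝ => |green Z v (relBall Z G u L) E x y| :=
      continuous_abs.measurable.comp this
    exact measurable_const.mul habs

lemma dirichlet_congr {Λ : Finset V} {v v' : V → ℝ} (h : ∀ x ∈ Λ, v x = v' x) :
    dirichlet Z v Λ = dirichlet Z v' Λ := by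
  ext x y
  simp [dirichlet, schrodinger, h x x.2]

lemma nonsingular_congr {p : Params} {m : ℝ} {G : Finset V} {u : V} {L : ℝ} {v v' : V → ℝ}
    (h : ∀ x ∈ relBall Z G u L, v x = v' x) :
    Nonsingular p Z v E m G u L ↔ Nonsingular p Z v' E m G u L := by
  simp only [Nonsingular, spec, green, dirichlet_congr h]

open Classical in
/-- The extension by zero of a potential on `Λ`. -/
noncomputable def extendZero (Λ : Finset V) (t : Λ → ℝ) (x : V) : ℝ :=
  if h : x ∈ Λ then t ⟨x, h⟩ else 0

lemma extendZero_apply {Λ : Finset V} (v : V → ℝ) {x : V} (hx : x ∈ Λ) :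
    extendZero Λ (fun y => v y) x = v x := by
  simp [extendZero, hx]

lemma measurable_extendZero (Λ : Finset V) : Measurable (extendZero Λ) := by
  refine measurable_pi_lambda _ fun x => ?_
  by_cases hx : x ∈ Λ
  · simpa [extendZero, hx] using measurable_pi_apply (⟨x, hx⟩ : Λ)
  · simp [extendZero, hx]

variable {Ω : Type v} [MeasurableSpace Ω] {μ : Measure Ω} {X : V → Ω → ℝ}

/-- Disjoint balls are singular independently of each other. -/
lemma measureReal_singular_inter (hX : ∀ x, Measurable (X x)) (hind : iIndepFun X μ)
    (p : Params) (m : ℝ) (G : Finset V) (w w' : V) (l : ℝ)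
    (hdisj : Disjoint (relBall Z G w l) (relBall Z G w' l)) :
    μ.real ({ω | ¬ Nonsingular p Z (fun x => X x ω) E m G w l} ∩
        {ω | ¬ Nonsingular p Z (fun x => X x ω) E m G w' l})
      = μ.real {ω | ¬ Nonsingular p Z (fun x => X x ω) E m G w l} *
        μ.real {ω | ¬ Nonsingular p Z (fun x => X x ω) E m G w' l} := by
  have hset : ∀ w, {ω | ¬ Nonsingular p Z (fun x => X x ω) E m G w l}
      = (fun ω (x : relBall Z G w l) => X x ω) ⁻¹'
        {t | ¬ Nonsingular p Z (extendZero (relBall Z G w l) t) E m G w l} := fun w => by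
    ext ω
    refine not_congr (nonsingular_congr fun x hx => ?_)
    exact (extendZero_apply (fun x => X x ω) hx).symm
  have hmeas : ∀ w, MeasurableSet
      {t | ¬ Nonsingular p Z (extendZero (relBall Z G w l) t) E m G w l} := fun w =>
    (measurable_extendZero (relBall Z G w l))
      (measurableSet_nonsingular (Z := Z) (E := E) p m G w l).compl
  have h := (hind.indepFun_finset _ _ hdisj hX).measure_inter_preimage_eq_mul _ _
    (hmeas w) (hmeas w')
  rw [hset w, hset w', measureReal_def, measureReal_def, measureReal_def, h, ENNReal.toReal_mul]

end

section

variable {V : Type u} {Z : SimpleGraph V} {E : ℝ}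
variable {Ω : Type v} [MeasurableSpace Ω] {μ : Measure Ω} {X : V → Ω → ℝ}

/-! ### The Wegner estimate -/

/-- A random variable with Lipschitz distribution function, shifted by an independent one, is
unlikely to be small. -/
lemma measureReal_abs_add_le [IsProbabilityMeasure μ] {T Y : Ω → ℝ} (hT : Measurable T)
    (hY : Measurable Y) (hTY : IndepFun T Y μ) {W : ℝ} (hW0 : 0 ≤ W)
    (hW : ∀ t s : ℝ, 0 ≤ s → cdf (μ.map T) (t + s) - cdf (μ.map T) t ≤ W * s) {r : ℝ}
    (hr : 0 < r) : μ.real {ω | |T ω + Y ω| ≤ r} ≤ 4 * W * r := by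
  have hpT : IsProbabilityMeasure (μ.map T) := Measure.isProbabilityMeasure_map hT.aemeasurable
  have hpY : IsProbabilityMeasure (μ.map Y) := Measure.isProbabilityMeasure_map hY.aemeasurable
  have hS : MeasurableSet {z : ℝ × ℝ | |z.1 + z.2| ≤ r} :=
    measurableSet_le (continuous_abs.measurable.comp (measurable_fst.add measurable_snd))
      measurable_const
  have hslice : ∀ y : ℝ, μ.map T ((fun t => (t, y)) ⁻¹' {z : ℝ × ℝ | |z.1 + z.2| ≤ r})
      ≤ ENNReal.ofReal (4 * W * r) := fun y => by
    -- the closed interval is enlarged to a half-open one, whose measure the cdf gives directly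
    have hsub : (fun t => (t, y)) ⁻¹' {z : ℝ × ℝ | |z.1 + z.2| ≤ r}
        ⊆ Set.Ioc (-y - 3 * r) (-y - 3 * r + 4 * r) := fun t ht => by
      have := abs_le.1 (show |t + y| ≤ r from ht)
      constructor <;> linarith
    refine (measure_mono hsub).trans ?_
    rw [← measure_cdf (μ.map T), StieltjesFunction.measure_Ioc]
    refine ENNReal.ofReal_le_ofReal ((hW _ _ (by positivity)).trans (le_of_eq ?_))
    ring
  have hmain : μ {ω | |T ω + Y ω| ≤ r} ≤ ENNReal.ofReal (4 * W * r) := by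
    have h1 : μ {ω | |T ω + Y ω| ≤ r}
        = μ.map (fun ω => (T ω, Y ω)) {z : ℝ × ℝ | |z.1 + z.2| ≤ r} := by
      rw [Measure.map_apply (hT.prodMk hY) hS]
      rfl
    rw [h1, hTY.map_prod_eq_prod_map_map hT.aemeasurable hY.aemeasurable,
      Measure.prod_apply_symm hS]
    calc _ ≤ ∫⁻ _y, ENNReal.ofReal (4 * W * r) ∂(μ.map Y) := lintegral_mono hslice
      _ = ENNReal.ofReal (4 * W * r) := by simp
  exact ENNReal.toReal_le_of_le_ofReal (by positivity) hmain

open Classical in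
/-- Weak-type bound for the diagonal Green function at complex energies. -/
lemma measureReal_le_norm_inv_apply_self_le [IsProbabilityMeasure μ] {W : ℝ} (hW : 0 ≤ W)
    (hX : LipschitzIID μ X W) (Λ : Finset V) (x : Λ) (z : ℂ) {r : ℝ} (hr : 0 < r) :
    μ.real {ω | r ≤ ‖(((dirichlet Z (fun y => X y ω) Λ).map (algebraMap ℝ ℂ)
      - z • (1 : Matrix Λ Λ ℂ))⁻¹) x x‖} ≤ 4 * W * r⁻¹ := by
  obtain ⟨hmeas, hind, -, hcdf⟩ := hX
  set Λ' : Finset V := Λ.erase x with hΛ'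
  set M : (V → ℝ) → Matrix Λ Λ ℂ := fun v =>
    (dirichlet Z v Λ).map (algebraMap ℝ ℂ) - z • (1 : Matrix Λ Λ ℂ) with hM
  -- the matrix is determined by the potential at `x` and by the potential on `Λ'`
  have hupd : ∀ v : V → ℝ, M v = (M (extendZero Λ' fun y => v y)).updateRow x
      (M (extendZero Λ' fun y => v y) x + ((v x : ℝ) : ℂ) • Pi.single x 1) := fun v => by
    ext i j
    by_cases hi : i = x
    · subst hi
      by_cases hj : i = j
      · subst hj
        have h0 : extendZero Λ' (fun y => v y) i = 0 := by simp [extendZero, hΛ']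
        simp [hM, dirichlet, schrodinger, h0]
        ring
      · simp [hM, dirichlet, schrodinger, hj, eq_comm]
    · have hi' : (i : V) ∈ Λ' :=
        Finset.mem_erase.2 ⟨fun h => hi (Subtype.ext h), i.2⟩
      simp [hM, dirichlet, schrodinger, Matrix.updateRow_ne hi, extendZero_apply v hi']
  set A : (Λ' → ℝ) → ℝ := fun t =>
    ((M (extendZero Λ' t)).det / (M (extendZero Λ' t)).adjugate x x).re with hA
  have hMmeas : ∀ i j, Measurable fun t : Λ' → ℝ => M (extendZero Λ' t) i j := fun i j => by
    have h1 : Measurable fun v : V → ℝ => M v i j := by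
      simp only [hM, Matrix.sub_apply, Matrix.map_apply]
      exact (Complex.measurable_ofReal.comp (measurable_dirichlet_apply Λ i j)).sub
        measurable_const
    exact h1.comp (measurable_extendZero Λ')
  have hAmeas : Measurable A :=
    Complex.measurable_re.comp ((measurable_det hMmeas).div (measurable_adjugate_apply hMmeas x x))
  have hYmeas : Measurable fun ω => A fun y : Λ' => X y ω :=
    hAmeas.comp (measurable_pi_lambda _ fun y => hmeas y)
  have hindep : IndepFun (X x) (fun ω => A fun y : Λ' => X y ω) μ := by
    have hdisj : Disjoint ({(x : V)} : Finset V) Λ' := by simp [hΛ']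
    have h := hind.indepFun_finset _ _ hdisj hmeas
    exact h.comp (φ := fun t : ({(x : V)} : Finset V) → ℝ => t ⟨x, by simp⟩) (ψ := A)
      (measurable_pi_apply _) hAmeas
  refine le_trans (measureReal_mono fun ω hω => ?_)
    (measureReal_abs_add_le (hmeas x) hYmeas hindep hW (hcdf x) (inv_pos.2 hr))
  have hω' : r ≤ ‖(M fun y => X y ω)⁻¹ x x‖ := hω
  rw [hupd] at hω'
  exact abs_add_re_det_div_adjugate_le hr hω'

/-- The Wegner estimate, with a volume factor `|Λ|²` (not optimal, but harmless here). -/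
lemma measureReal_infDist_spec_lt_le [IsProbabilityMeasure μ] {W : ℝ} (hW : 0 ≤ W)
    (hX : LipschitzIID μ X W) {Λ : Finset V} (hΛ : Λ.Nonempty) (E : ℝ) {ε : ℝ} (hε : 0 < ε) :
    μ.real {ω | Metric.infDist E (spec Z (fun x => X x ω) Λ) < ε}
      ≤ 8 * W * ε * (Λ.card : ℝ) ^ 2 := by
  classical
  have : Nonempty Λ := hΛ.to_subtype
  have hcard : (0 : ℝ) < Λ.card := by exact_mod_cast hΛ.card_pos
  set r : ℝ := (2 * ε * Λ.card)⁻¹ with hr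
  have hsub : {ω | Metric.infDist E (spec Z (fun x => X x ω) Λ) < ε} ⊆
      ⋃ x : Λ, {ω | r ≤ ‖(((dirichlet Z (fun y => X y ω) Λ).map (algebraMap ℝ ℂ)
        - (E + ε * Complex.I : ℂ) • (1 : Matrix Λ Λ ℂ))⁻¹) x x‖} := fun ω hω => by
    have hH := dirichlet_isHermitian (Z := Z) (v := fun x => X x ω) Λ
    have hne : (spec Z (fun x => X x ω) Λ).Nonempty := by
      unfold spec
      rw [hH.spectrum_real_eq_range_eigenvalues]
      exact Set.range_nonempty _
    obtain ⟨t, ht, hEt⟩ := (Metric.infDist_lt_iff hne).1 hω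
    rw [dist_comm, Real.dist_eq] at hEt
    obtain ⟨x, hx⟩ := exists_le_norm_inv_apply_self hH hε ht hEt.le
    rw [Fintype.card_coe] at hx
    exact Set.mem_iUnion.2 ⟨x, hx⟩
  calc _ ≤ μ.real (⋃ x : Λ, {ω | r ≤ ‖(((dirichlet Z (fun y => X y ω) Λ).map (algebraMap ℝ ℂ)
        - (E + ε * Complex.I : ℂ) • (1 : Matrix Λ Λ ℂ))⁻¹) x x‖}) := measureReal_mono hsub
    _ ≤ ∑ x : Λ, μ.real {ω | r ≤ ‖(((dirichlet Z (fun y => X y ω) Λ).map (algebraMap ℝ ℂ)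
        - (E + ε * Complex.I : ℂ) • (1 : Matrix Λ Λ ℂ))⁻¹) x x‖} :=
        measureReal_iUnion_fintype_le _
    _ ≤ ∑ _x : Λ, 4 * W * r⁻¹ := Finset.sum_le_sum fun x _ =>
        measureReal_le_norm_inv_apply_self_le hW hX Λ x _ (by positivity)
    _ = 8 * W * ε * (Λ.card : ℝ) ^ 2 := by
        rw [Finset.sum_const, Finset.card_univ, Fintype.card_coe, nsmul_eq_mul, hr, inv_inv]
        ring

end

section

variable {V : Type u} {Z : SimpleGraph V} {E : ℝ}
variable {Ω : Type v} [MeasurableSpace Ω] {μ : Measure Ω} {X : V → Ω → ℝ}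

/-! ### The scaling recursion -/

lemma measureReal_singular_le_probSingular [IsProbabilityMeasure μ] (p : Params) (m l : ℝ)
    {G : Finset V} (hG : (Z.induce (G : Set V)).Connected) {u : V} (hu : u ∈ G) :
    μ.real {ω | ¬ Nonsingular p Z (fun x => X x ω) E m G u l} ≤ probSingular p Z μ X E m l := by
  refine le_csSup ⟨1, ?_⟩ ⟨G, u, hG, hu, rfl⟩
  rintro _ ⟨_, _, _, _, rfl⟩
  exact measureReal_le_one

lemma measureReal_resonant_le_probResonant [IsProbabilityMeasure μ] (p : Params) (L : ℝ)
    {G : Finset V} (hG : (Z.induce (G : Set V)).Connected) {u : V} (hu : u ∈ G) :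
    μ.real {ω | Resonant p Z (fun x => X x ω) E G u L} ≤ 1 / 2 * probResonant p Z μ X E L := by
  have h := le_csSup (s := {r : ℝ | ∃ (G : Finset V) (u : V), (Z.induce (G : Set V)).Connected ∧
    u ∈ G ∧ r = μ.real {ω | Resonant p Z (fun x => X x ω) E G u L}}) ⟨1, by
      rintro _ ⟨_, _, _, _, rfl⟩
      exact measureReal_le_one⟩ ⟨G, u, hG, hu, rfl⟩
  rw [probResonant]
  linarith

lemma probSingular_nonneg (p : Params) (m l : ℝ) : 0 ≤ probSingular p Z μ X E m l := by
  refine Real.sSup_nonneg ?_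
  rintro _ ⟨_, _, _, _, rfl⟩
  exact measureReal_nonneg

lemma probResonant_nonneg (p : Params) (L : ℝ) : 0 ≤ probResonant p Z μ X E L := by
  refine mul_nonneg (by norm_num) (Real.sSup_nonneg ?_)
  rintro _ ⟨_, _, _, _, rfl⟩
  exact measureReal_nonneg

lemma probResonant_le [IsProbabilityMeasure μ] {p : Params} (hC : 0 < p.C) (hd : 0 < p.d)
    (hZ : PolynomialGrowth Z p.C p.d) {W : ℝ} (hW : 0 ≤ W) (hX : LipschitzIID μ X W) (E : ℝ)
    {L : ℝ} (hL : 1 ≤ L) :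
    probResonant p Z μ X E L ≤ 16 * W * Real.exp (-L ^ p.β) * (p.C * L ^ p.d) ^ 2 := by
  have hL0 : 0 < L := by linarith
  have h : sSup {r : ℝ | ∃ (G : Finset V) (u : V), (Z.induce (G : Set V)).Connected ∧ u ∈ G ∧
      r = μ.real {ω | Resonant p Z (fun x => X x ω) E G u L}}
        ≤ 8 * W * Real.exp (-L ^ p.β) * (p.C * L ^ p.d) ^ 2 := by
    refine Real.sSup_le ?_ (by positivity)
    rintro _ ⟨G, u, hG, hu, rfl⟩
    refine (measureReal_infDist_spec_lt_le hW hX ⟨u, mem_relBall_self hu hL0.le⟩ E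
      (Real.exp_pos _)).trans ?_
    have := card_relBall_le hC.le hd.le hZ hG hu hL
    gcongr
  rw [probResonant]
  linarith

/-- One step of the scaling: a ball that is nonsingular whenever it is nonresonant and contains no
pair of disjoint singular balls of the smaller scale satisfies the recursion below. The pairs are
unordered, which is where the factor `1 / 2` comes from. -/
lemma probSingular_le_of_step [IsProbabilityMeasure μ] {p : Params} (hC : 0 < p.C)
    (hd : 0 < p.d) (hZ : PolynomialGrowth Z p.C p.d) {W : ℝ} (hX : LipschitzIID μ X W)
    {m l L : ℝ} (hl : 0 ≤ l) (hL : 1 ≤ L)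
    (hstep : ∀ (v : V → ℝ) (G : Finset V) (u : V),
        (Z.induce (G : Set V)).Connected → u ∈ G → ¬ Resonant p Z v E G u L →
        (∀ w ∈ relBall Z G u L, ∀ w' ∈ relBall Z G u L,
          ¬ Nonsingular p Z v E m (relBall Z G u L) w l →
          ¬ Nonsingular p Z v E m (relBall Z G u L) w' l →
          ¬ Disjoint (relBall Z (relBall Z G u L) w l) (relBall Z (relBall Z G u L) w' l)) →
        Nonsingular p Z v E m G u L) :
    probSingular p Z μ X E m L ≤
      1 / 2 * (p.C * L ^ p.d) ^ 2 * probSingular p Z μ X E m l ^ 2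
        + 1 / 2 * probResonant p Z μ X E L := by
  classical
  have hP := probSingular_nonneg (Z := Z) (E := E) (μ := μ) (X := X) p m l
  have hQ := probResonant_nonneg (Z := Z) (E := E) (μ := μ) (X := X) p L
  refine Real.sSup_le ?_ (by positivity)
  rintro _ ⟨G, u, hG, hu, rfl⟩
  set B := relBall Z G u L with hBdef
  have hB : (Z.induce (B : Set V)).Connected := relBall_connected hG hu (by linarith)
  set S : V → Set Ω := fun w => {ω | ¬ Nonsingular p Z (fun x => X x ω) E m B w l} with hS
  set D : Finset V → Set Ω := fun s => {ω |
    (∀ w ∈ s, ∀ w' ∈ s, w ≠ w' → Disjoint (relBall Z B w l) (relBall Z B w' l)) ∧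
      ∀ w ∈ s, ω ∈ S w} with hD
  have hsub : {ω | ¬ Nonsingular p Z (fun x => X x ω) E m G u L} ⊆
      (⋃ s ∈ B.powersetCard 2, D s) ∪ {ω | Resonant p Z (fun x => X x ω) E G u L} := by
    intro ω hω
    by_contra hcon
    rw [Set.mem_union, not_or] at hcon
    refine hω (hstep _ G u hG hu hcon.2 fun w hw w' hw' hs hs' hdisj => hcon.1 ?_)
    have hne : w ≠ w' := by
      rintro rfl
      exact Finset.disjoint_left.1 hdisj (mem_relBall_self hw hl) (mem_relBall_self hw hl)
    refine Set.mem_biUnion (x := {w, w'}) ?_ ⟨?_, ?_⟩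
    · refine Finset.mem_coe.2 (Finset.mem_powersetCard.2 ⟨?_, Finset.card_pair hne⟩)
      intro a ha
      rcases Finset.mem_insert.1 ha with rfl | ha
      · exact hw
      · rwa [Finset.mem_singleton.1 ha]
    · intro a ha a' ha' haa'
      simp only [Finset.mem_insert, Finset.mem_singleton] at ha ha'
      rcases ha with rfl | rfl <;> rcases ha' with rfl | rfl
      · exact absurd rfl haa'
      · exact hdisj
      · exact hdisj.symm
      · exact absurd rfl haa'
    · intro a ha
      simp only [Finset.mem_insert, Finset.mem_singleton] at ha
      rcases ha with rfl | rfl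
      · exact hs
      · exact hs'
  have hDle : ∀ s ∈ B.powersetCard 2, μ.real (D s) ≤ probSingular p Z μ X E m l ^ 2 := by
    intro s hs
    obtain ⟨hsB, hs2⟩ := Finset.mem_powersetCard.1 hs
    obtain ⟨a, b, hab, rfl⟩ := Finset.card_eq_two.1 hs2
    have ha : a ∈ B := hsB (by simp)
    have hb : b ∈ B := hsB (by simp)
    by_cases hdisj : Disjoint (relBall Z B a l) (relBall Z B b l)
    · calc μ.real (D {a, b}) ≤ μ.real (S a ∩ S b) :=
            measureReal_mono fun ω hω => ⟨hω.2 a (by simp), hω.2 b (by simp)⟩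
        _ = μ.real (S a) * μ.real (S b) :=
            measureReal_singular_inter hX.1 hX.2.1 p m B a b l hdisj
        _ ≤ probSingular p Z μ X E m l * probSingular p Z μ X E m l :=
            mul_le_mul (measureReal_singular_le_probSingular p m l hB ha)
              (measureReal_singular_le_probSingular p m l hB hb) measureReal_nonneg hP
        _ = _ := (sq _).symm
    · have : D {a, b} = ∅ := Set.eq_empty_of_forall_notMem fun ω hω =>
        hdisj (hω.1 a (by simp) b (by simp) hab)
      rw [this, measureReal_empty]
      positivity
  have hcard : ((B.powersetCard 2).card : ℝ) ≤ 1 / 2 * (p.C * L ^ p.d) ^ 2 := by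
    rw [Finset.card_powersetCard]
    calc ((B.card.choose 2 : ℕ) : ℝ) ≤ (B.card : ℝ) ^ 2 / (Nat.factorial 2 : ℕ) :=
          Nat.choose_le_pow_div _ _
      _ ≤ (p.C * L ^ p.d) ^ 2 / (Nat.factorial 2 : ℕ) := by
          have := card_relBall_le hC.le hd.le hZ hG hu hL
          gcongr
      _ = _ := by
          norm_num [Nat.factorial]
          ring
  calc _ ≤ μ.real ((⋃ s ∈ B.powersetCard 2, D s) ∪
            {ω | Resonant p Z (fun x => X x ω) E G u L}) := measureReal_mono hsub
    _ ≤ μ.real (⋃ s ∈ B.powersetCard 2, D s) +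
          μ.real {ω | Resonant p Z (fun x => X x ω) E G u L} := measureReal_union_le _ _
    _ ≤ (∑ s ∈ B.powersetCard 2, μ.real (D s)) +
          μ.real {ω | Resonant p Z (fun x => X x ω) E G u L} := by
        gcongr
        exact measureReal_biUnion_finset_le _ _
    _ ≤ (B.powersetCard 2).card * probSingular p Z μ X E m l ^ 2 +
          1 / 2 * probResonant p Z μ X E L := by
        refine add_le_add ?_ (measureReal_resonant_le_probResonant p L hG hu)
        rw [← nsmul_eq_mul]
        exact Finset.sum_le_card_nsmul _ _ _ hDle
    _ ≤ _ := by gcongr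

/-! ### The length scales -/

lemma le_scale {α : ℝ} (hα : 1 ≤ α) {L₀ : ℕ} (hL₀ : 1 ≤ L₀) (k : ℕ) :
    (L₀ : ℝ) ≤ scale α L₀ k := by
  induction k with
  | zero => exact le_rfl
  | succ k ih =>
    have h1 : (1 : ℝ) ≤ L₀ := by exact_mod_cast hL₀
    exact ih.trans (Real.self_le_rpow_of_one_le (h1.trans ih) hα)

/-- Powers of the length scales grow faster than `2 ^ k`. -/
lemma two_pow_le_scale_rpow {α b : ℝ} (hα : 1 ≤ α) (hb : 0 < b) {L₀ : ℕ} (hL₀ : 1 ≤ L₀)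
    (h2 : 2 ≤ (L₀ : ℝ) ^ ((α - 1) * b)) (k : ℕ) : 2 ^ k ≤ scale α L₀ k ^ b := by
  have h1 : (1 : ℝ) ≤ L₀ := by exact_mod_cast hL₀
  induction k with
  | zero => simpa [scale] using Real.one_le_rpow h1 hb.le
  | succ k ih =>
    have hk := le_scale hα hL₀ k
    have hk0 : 0 < scale α L₀ k := by linarith
    have h3 : scale α L₀ (k + 1) ^ b = scale α L₀ k ^ b * scale α L₀ k ^ ((α - 1) * b) := by
      rw [scale, ← Real.rpow_mul hk0.le, ← Real.rpow_add hk0]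
      ring_nf
    rw [h3, pow_succ]
    refine mul_le_mul ih (h2.trans ?_) (by norm_num) (by positivity)
    exact Real.rpow_le_rpow (by linarith) hk (mul_nonneg (by linarith) hb.le)

/-- The resonance probabilities given by the Wegner estimate are eventually below
`L ^ (-κ t)`, uniformly for `t` up to a power of `L`. -/
lemma eventually_wegner_bound_le (p : Params) (hC : 0 < p.C) (hβ : 0 < p.β) {W : ℝ} (hW : 0 < W)
    {κ : ℝ} (hκ : 0 ≤ κ) :
    ∀ᶠ L : ℝ in atTop, ∀ t : ℝ, t ≤ L ^ (p.β / 4) →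
      16 * W * Real.exp (-L ^ p.β) * (p.C * L ^ p.d) ^ 2
        ≤ p.C ^ (-2 : ℤ) * L ^ (-(κ * t)) := by
  have e1 := eventually_add_mul_log_le (a := Real.log (16 * W * p.C ^ 4)) (b := 2 * p.d)
    (c := 1 / 2) (r := p.β) hβ (by norm_num)
  have e2 := eventually_add_mul_log_le (a := 0) (b := 1) (c := 1) (r := p.β / 4) (by positivity)
    (by norm_num)
  have e3 := eventually_rpow_le_mul_rpow (a := p.β / 2) (b := p.β) (c := 1 / (2 * (κ + 1)))
    (by linarith) (by positivity)
  filter_upwards [e1, e2, e3, eventually_ge_atTop 1] with L h1 h2 h3 hL1 t ht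
  have hL0 : 0 < L := by linarith
  have hlog : 0 ≤ Real.log L := Real.log_nonneg hL1
  have h4 : κ * t * Real.log L ≤ 1 / 2 * L ^ p.β := by
    calc κ * t * Real.log L = κ * (t * Real.log L) := by ring
      _ ≤ κ * (L ^ (p.β / 4) * L ^ (p.β / 4)) := by
          have : Real.log L ≤ L ^ (p.β / 4) := by linarith
          gcongr
      _ = κ * L ^ (p.β / 2) := by
          rw [← Real.rpow_add hL0]
          ring_nf
      _ ≤ (κ + 1) * (1 / (2 * (κ + 1)) * L ^ p.β) := by
          gcongr
          linarith
      _ = 1 / 2 * L ^ p.β := by field_simp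
  have hlhs : 16 * W * Real.exp (-L ^ p.β) * (p.C * L ^ p.d) ^ 2 = p.C ^ (-2 : ℤ) *
      Real.exp (Real.log (16 * W * p.C ^ 4) + 2 * p.d * Real.log L - L ^ p.β) := by
    have h5 : L ^ p.d = Real.exp (p.d * Real.log L) := by
      rw [Real.rpow_def_of_pos hL0, mul_comm]
    have h6 : Real.exp (2 * p.d * Real.log L) = Real.exp (p.d * Real.log L) ^ 2 := by
      rw [← Real.exp_nat_mul]
      push_cast
      ring_nf
    rw [sub_eq_add_neg, Real.exp_add, Real.exp_add, Real.exp_log (by positivity), h5, h6]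
    rw [zpow_neg]
    field_simp
  rw [hlhs, Real.rpow_def_of_pos hL0 (-(κ * t))]
  gcongr
  linarith

/-! ### Reproduction of the probability bounds -/

/-- If the exponents satisfy `α κ t' ≤ 2 κ t - 2 α d`, the bound with exponent `κ t` at scale `l`
implies the bound with exponent `κ t'` at scale `l ^ α`. -/
lemma le_of_recursion {C d α κ t t' l P P' Q : ℝ} (hC : 0 < C) (hl : 1 ≤ l)
    (hP0 : 0 ≤ P) (hP : P ≤ C ^ (-2 : ℤ) * l ^ (-(κ * t)))
    (hQ : Q ≤ C ^ (-2 : ℤ) * (l ^ α) ^ (-(κ * t')))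
    (hP' : P' ≤ 1 / 2 * (C * (l ^ α) ^ d) ^ 2 * P ^ 2 + 1 / 2 * Q)
    (ht : α * (κ * t') ≤ 2 * (κ * t) - 2 * α * d) :
    P' ≤ C ^ (-2 : ℤ) * (l ^ α) ^ (-(κ * t')) := by
  have hl0 : 0 < l := by linarith
  have h1 : (C * (l ^ α) ^ d) ^ 2 * P ^ 2 ≤ C ^ (-2 : ℤ) * (l ^ α) ^ (-(κ * t')) := by
    calc (C * (l ^ α) ^ d) ^ 2 * P ^ 2
        ≤ (C * (l ^ α) ^ d) ^ 2 * (C ^ (-2 : ℤ) * l ^ (-(κ * t))) ^ 2 := by gcongr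
      _ = C ^ (-2 : ℤ) * (((l ^ α) ^ d) ^ 2 * (l ^ (-(κ * t))) ^ 2) := by
          rw [zpow_neg]
          field_simp
      _ = C ^ (-2 : ℤ) * l ^ (2 * α * d - 2 * (κ * t)) := by
          congr 1
          rw [← Real.rpow_mul hl0.le, ← Real.rpow_natCast, ← Real.rpow_natCast,
            ← Real.rpow_mul hl0.le, ← Real.rpow_mul hl0.le, ← Real.rpow_add hl0]
          push_cast
          ring_nf
      _ ≤ C ^ (-2 : ℤ) * (l ^ α) ^ (-(κ * t')) := by
          rw [← Real.rpow_mul hl0.le]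
          gcongr
          linarith
  linarith

end

end MSA

theorem mainTheorem4
    (p : MSA.Params) (hd : 0 < p.d) (hC : 0 < p.C)
    (hα₁ : 1 < p.α) (hα₂ : p.α < 2)
    (hβ : 0 < p.β) (hτ : 0 < p.τ) (hτϱ : p.τ < p.ϱ) (hϱ : p.ϱ < p.α - 1)
    (hβτ : p.α * p.β + p.τ < 1 + p.ϱ)
    (W : ℝ) (hW : 0 < W) (m₀ : ℝ) (hm₀ : 0 < m₀)
    (κ : ℝ) (hκ : 2 * p.α * p.d / (2 - p.α) ≤ κ) :
    ∃ Lstar : ℕ, 1 ≤ Lstar ∧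
      ∀ {V : Type*} [Countable V] (Z : SimpleGraph V) {Ω : Type*} [MeasurableSpace Ω]
        (μ : Measure Ω) [IsProbabilityMeasure μ] (X : V → Ω → ℝ),
        Z.Connected → MSA.PolynomialGrowth Z p.C p.d → MSA.LipschitzIID μ X W →
        ∀ (E m : ℝ), m₀ ≤ m → ∀ L₀ : ℕ, Lstar ≤ L₀ →
          -- reproduction of the power-law bound at all scales
          (max (MSA.probSingular p Z μ X E m (MSA.scale p.α L₀ 0))
              (MSA.probResonant p Z μ X E (MSA.scale p.α L₀ 0))
                ≤ p.C ^ (-2 : ℤ) * MSA.scale p.α L₀ 0 ^ (-κ) →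
            ∀ k : ℕ, MSA.probSingular p Z μ X E m (MSA.scale p.α L₀ k)
                ≤ p.C ^ (-2 : ℤ) * MSA.scale p.α L₀ k ^ (-κ)) ∧
          -- improvement to a decay faster than any power law
          (2 * p.α * p.d / (2 - p.α) < κ →
            ∀ θ : ℝ, θ = 2 / p.α - 2 * p.d / κ - 1 →
              0 < θ ∧
              ∀ k₀ : ℕ, MSA.probSingular p Z μ X E m (MSA.scale p.α L₀ k₀)
                  ≤ p.C ^ (-2 : ℤ) * MSA.scale p.α L₀ k₀ ^ (-(κ * (1 + θ) ^ k₀)) →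
                (∀ k : ℕ, k₀ ≤ k → MSA.probSingular p Z μ X E m (MSA.scale p.α L₀ k)
                  ≤ p.C ^ (-2 : ℤ) * MSA.scale p.α L₀ k ^ (-(κ * (1 + θ) ^ k))) ∧
                ∀ A : ℝ, Tendsto (fun k : ℕ => MSA.scale p.α L₀ k ^ A *
                  MSA.probSingular p Z μ X E m (MSA.scale p.α L₀ k)) atTop (𝓝 0)) := by
  have hbβ : 0 < p.β / 4 := by positivity
  have hα0 : 0 < p.α := by linarith
  have hκ0 : 0 < κ := lt_of_lt_of_le (div_pos (by positivity) (by linarith)) hκ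
  have hκ' : 2 * p.α * p.d ≤ κ * (2 - p.α) := (div_le_iff₀ (by linarith)).1 hκ
  obtain ⟨l₁, hl₁⟩ := eventually_atTop.1
    (MSA.eventually_nonsingular p hC hd hα₁ hα₂ hτ hτϱ hϱ hβτ hm₀)
  obtain ⟨l₂, hl₂⟩ := eventually_atTop.1 (MSA.eventually_wegner_bound_le p hC hβ hW hκ0.le)
  obtain ⟨l₃, hl₃⟩ := eventually_atTop.1 ((tendsto_rpow_atTop
    (mul_pos (sub_pos.2 hα₁) hbβ)).eventually_ge_atTop 2)
  refine ⟨max 1 ⌈max l₁ (max l₂ l₃)⌉₊, le_max_left _ _, ?_⟩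
  intro V _ Z Ω _ μ _ X _ hZ hX E m hm L₀ hL₀
  have hL₀1 : 1 ≤ L₀ := (le_max_left _ _).trans hL₀
  have hL₀' : max l₁ (max l₂ l₃) ≤ L₀ :=
    (Nat.le_ceil _).trans (by exact_mod_cast (le_max_right _ _).trans hL₀)
  have hscale := MSA.le_scale hα₁.le hL₀1
  have hs1 : ∀ k, 1 ≤ MSA.scale p.α L₀ k := fun k =>
    le_trans (by exact_mod_cast hL₀1) (hscale k)
  have hs0 : ∀ k, 0 < MSA.scale p.α L₀ k := fun k => by linarith [hs1 k]
  have htwo := MSA.two_pow_le_scale_rpow hα₁.le hbβ hL₀1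
    (hl₃ _ ((le_max_right _ _).trans ((le_max_right _ _).trans hL₀')))
  -- the exponents `κ` and `κ (1 + θ) ^ k` of the two parts are both covered by `t ≤ 2 ^ k`
  have hQ : ∀ k t, t ≤ (2 : ℝ) ^ k → MSA.probResonant p Z μ X E (MSA.scale p.α L₀ k)
      ≤ p.C ^ (-2 : ℤ) * MSA.scale p.α L₀ k ^ (-(κ * t)) := fun k t ht =>
    (MSA.probResonant_le hC hd hZ hW.le hX E (hs1 k)).trans
      (hl₂ _ (((le_max_left _ _).trans (le_max_right _ _)).trans (hL₀'.trans (hscale k))) t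
        (ht.trans (htwo k)))
  -- the step from scale `k` to scale `k + 1`
  have hstep : ∀ k t t', t' ≤ (2 : ℝ) ^ (k + 1) →
      p.α * (κ * t') ≤ 2 * (κ * t) - 2 * p.α * p.d →
      MSA.probSingular p Z μ X E m (MSA.scale p.α L₀ k)
        ≤ p.C ^ (-2 : ℤ) * MSA.scale p.α L₀ k ^ (-(κ * t)) →
      MSA.probSingular p Z μ X E m (MSA.scale p.α L₀ (k + 1))
        ≤ p.C ^ (-2 : ℤ) * MSA.scale p.α L₀ (k + 1) ^ (-(κ * t')) := fun k t t' ht' htt' hP =>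
    MSA.le_of_recursion hC (hs1 k) (MSA.probSingular_nonneg p m _) hP (hQ (k + 1) t' ht')
      (MSA.probSingular_le_of_step hC hd hZ hX (hs0 k).le (hs1 (k + 1)) fun v G u hG hu =>
        hl₁ _ ((le_max_left _ _).trans (hL₀'.trans (hscale k))) Z hZ v E m hm G u hG hu) htt'
  refine ⟨fun h0 k => ?_, fun hκs θ hθ => ?_⟩
  · induction k with
    | zero => exact (le_max_left _ _).trans h0
    | succ k ih =>
      have := hstep k 1 1 (one_le_pow₀ (by norm_num)) (by linarith)
      rw [mul_one] at this
      exact this ih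
  · have hθ0 : 0 < θ := by
      have h1 : 2 * p.α * p.d < κ * (2 - p.α) := (div_lt_iff₀ (by linarith)).1 hκs
      have h2 : θ = (κ * (2 - p.α) - 2 * p.α * p.d) / (p.α * κ) := by
        rw [hθ]
        field_simp
        ring
      rw [h2]
      exact div_pos (by linarith) (by positivity)
    have hθα : p.α * (κ * (1 + θ)) = 2 * κ - 2 * p.α * p.d := by
      rw [hθ]
      field_simp
      ring
    have hθ2 : 1 + θ ≤ 2 := by
      have h1 : 0 < 2 * p.α * p.d := by positivity
      have h2 : κ * (1 + θ) ≤ p.α * (κ * (1 + θ)) :=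
        le_mul_of_one_le_left (by positivity) hα₁.le
      exact le_of_mul_le_mul_left (by linarith) hκ0
    refine ⟨hθ0, fun k₀ hk₀ => ?_⟩
    have hall : ∀ k : ℕ, k₀ ≤ k → MSA.probSingular p Z μ X E m (MSA.scale p.α L₀ k)
        ≤ p.C ^ (-2 : ℤ) * MSA.scale p.α L₀ k ^ (-(κ * (1 + θ) ^ k)) := by
      intro k hk
      induction k, hk using Nat.le_induction with
      | base => exact hk₀
      | succ k _ ih =>
        refine hstep k _ _ (by gcongr) ?_ ih
        -- the choice of `θ` leaves exactly the surplus `2 α d ((1 + θ) ^ k - 1) ≥ 0`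
        have h1 : 1 ≤ (1 + θ) ^ k := one_le_pow₀ (by linarith)
        have h2 : 0 < p.α * p.d := by positivity
        calc p.α * (κ * (1 + θ) ^ (k + 1)) = p.α * (κ * (1 + θ)) * (1 + θ) ^ k := by ring
          _ = 2 * (κ * (1 + θ) ^ k) - 2 * p.α * p.d * (1 + θ) ^ k := by rw [hθα]; ring
          _ ≤ _ := by nlinarith
    refine ⟨hall, fun A => ?_⟩
    -- once `κ (1 + θ) ^ k ≥ A + β / 4`, the product is at most `C⁻² L_k ^ (-β / 4) ≤ C⁻² 2 ^ (-k)`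
    have hgeo : Tendsto (fun k : ℕ => p.C ^ (-2 : ℤ) * (1 / 2 : ℝ) ^ k) atTop (𝓝 0) := by
      simpa using (tendsto_pow_atTop_nhds_zero_of_lt_one (r := (1 / 2 : ℝ)) (by norm_num)
        (by norm_num)).const_mul (p.C ^ (-2 : ℤ))
    have hexp : ∀ᶠ k : ℕ in atTop, A + p.β / 4 ≤ κ * (1 + θ) ^ k :=
      ((tendsto_pow_atTop_atTop_of_one_lt (by linarith)).const_mul_atTop hκ0).eventually_ge_atTop _
    refine tendsto_of_tendsto_of_tendsto_of_le_of_le' tendsto_const_nhds hgeo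
      (Eventually.of_forall fun k => mul_nonneg (Real.rpow_nonneg (hs0 k).le _)
        (MSA.probSingular_nonneg p m _)) ?_
    filter_upwards [hexp, eventually_ge_atTop k₀] with k hkA hk
    calc MSA.scale p.α L₀ k ^ A * MSA.probSingular p Z μ X E m (MSA.scale p.α L₀ k)
        ≤ MSA.scale p.α L₀ k ^ A *
            (p.C ^ (-2 : ℤ) * MSA.scale p.α L₀ k ^ (-(κ * (1 + θ) ^ k))) :=
          mul_le_mul_of_nonneg_left (hall k hk) (Real.rpow_nonneg (hs0 k).le _)
      _ = p.C ^ (-2 : ℤ) * MSA.scale p.α L₀ k ^ (A - κ * (1 + θ) ^ k) := by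
          rw [sub_eq_add_neg, Real.rpow_add (hs0 k)]
          ring
      _ ≤ p.C ^ (-2 : ℤ) * MSA.scale p.α L₀ k ^ (-(p.β / 4)) := by
          have := hs1 k
          gcongr
          linarith
      _ ≤ p.C ^ (-2 : ℤ) * (1 / 2 : ℝ) ^ k := by
          rw [Real.rpow_neg (hs0 k).le, one_div, inv_pow]
          have := htwo k
          gcongr
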